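/- Write $[N]=\{0,\dots,N-1\}$. A collision of $f:[N]\to[N]$ is an unordered pair $\{x,x'\}$ with $x\neq x'$ and $f(x)=f(x')$. Model: a quantum circuit on $S$ qubits is a predefined sequence of unitaries on the $S$ qubits, computational-basis measurements and resets of qubits, oracle gates $|x,p\rangle\mapsto e^{2\pi i\,p f(x)/N}|x,p\rangle$ for $x,p\in[N]$ (held in binary in two disjoint registers of $\lceil\log_2 N\rceil$ qubits; other bit strings are left unchanged), and output gates. An output gate copies a flag qubit and two registers of $\lceil\log_2 N\rceil$ qubits, in the computational basis, to fresh output qubits that are not used again and not counted in $S$; it outputs the pair of numbers in the two registers if the flag is $1$, and nothing otherwise. The circuit starts on $|0\cdots0\rangle$, and $T$ denotes its number of oracle gates. It finds $K$ collisions of $f$ if every pair that it outputs is a collision of $f$ and at least $K$ different collisions (not necessarily disjoint) are output. Proposition. There are constants $c,C>0$ such that for all $A>0$ and $b\in\mathbb N$ there are $B>0$ and $d\in\mathbb N$ with the following property. For all positive integers $N,K$ and all integers $S$ with $$1\le K\le cN,\qquad C\log N\le S\le A\,K^{2/3}N^{1/3}(\log N)^b,$$ there is a quantum circuit on $S$ qubits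 that finds $K$ collisions of a uniformly random function $f:[N]\to[N]$ with probability at least $2/3$ (over $f$ and the measurements) and makes $$T\le B\,K\sqrt{N/S}\,(\log N)^d$$ queries to $f$; moreover $T^2S\le B\,K^2N(\log N)^d$. -/

import Mathlib

namespace CollisionSearch

/-- The number of qubits used to hold an element of `[N] = {0, …, N - 1}` in binary. -/
def width (N : ℕ) : ℕ := Nat.clog 2 N

/-- Gates of a quantum circuit on `S` qubits with an oracle for a function `[N] → [N]`.
Only oracle gates are charged for, so the gates between two of them are arbitrary unitaries
on the `S` qubits (each is a product of one- and two-qubit gates on the same qubits).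
The circuit may also measure a qubit in the computational basis (the outcome is kept only in
the qubit itself) and reset a qubit to `|0⟩`. -/
inductive Gate (N S : ℕ) where
  /-- a unitary transformation of the memory -/
  | unitary (U : Matrix.unitaryGroup (Fin S → Bool) ℂ)
  /-- an oracle gate, applied to the query register (`Sum.inl`) and the phase register
  (`Sum.inr`), which are disjoint -/
  | query (reg : Fin (width N) ⊕ Fin (width N) ↪ Fin S)
  /-- measurement of a qubit in the computational basis -/
  | measure (q : Fin S)
  /-- reinitialization of a qubit to `|0⟩` -/
  | reset (q : Fin S)
  /-- output gate: the flag qubit and the two registers are copied (in the computational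
  basis) to fresh output qubits that are never used again -/
  | output (flag : Fin S) (x₁ x₂ : Fin (width N) ↪ Fin S)

/-- A circuit is a predefined sequence of gates. -/
abbrev Circuit (N S : ℕ) := List (Gate N S)

/-- Whether a gate is an oracle gate. -/
def Gate.isQuery {N S : ℕ} : Gate N S → Bool
  | .query _ => true
  | _ => false

/-- The number of queries made by a circuit. -/
def Circuit.queries {N S : ℕ} (C : Circuit N S) : ℕ := List.countP Gate.isQuery C

/-- Vectors of `(ℂ²)^{⊗ S}`, by their amplitudes in the computational basis. -/
abbrev State (S : ℕ) := (Fin S → Bool) → ℂ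

/-- The state `|0 ⋯ 0⟩`. -/
noncomputable def initialState (S : ℕ) : State S := Pi.single (fun _ => false) 1

/-- The squared Euclidean norm of a vector. -/
noncomputable def normSq {S : ℕ} (ψ : State S) : ℝ := ∑ s, Complex.normSq (ψ s)

/-- The number written in binary on the register `r` in the basis state `s`
(least significant bit first). -/
def readReg {S n : ℕ} (r : Fin n → Fin S) (s : Fin S → Bool) : ℕ :=
  Nat.ofBits (fun i => s (r i))

/-- The factor by which the oracle multiplies a basis state with contents `x`, `p` of the
query and phase registers: `ω_N ^ (p * f x)` with `ω_N = exp (2 π i / N)`. Bit strings that do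
not encode elements of `[N]` are left unchanged. -/
noncomputable def oraclePhase {N : ℕ} (f : Fin N → Fin N) (x p : ℕ) : ℂ :=
  if h : x < N ∧ p < N then
    Complex.exp (2 * Real.pi * Complex.I / N) ^ (p * (f ⟨x, h.1⟩ : ℕ))
  else 1

/-- The oracle for `f`. -/
noncomputable def applyOracle {N S : ℕ} (f : Fin N → Fin N)
    (reg : Fin (width N) ⊕ Fin (width N) ↪ Fin S) (ψ : State S) : State S := fun s =>
  oraclePhase f (readReg (fun i => reg (Sum.inl i)) s) (readReg (fun i => reg (Sum.inr i)) s) * ψ s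

/-- What an output gate writes: nothing (`none`) if the flag is `0`, and otherwise the pair of
numbers held by the two registers. -/
abbrev Word := Option (ℕ × ℕ)

open Classical in
/-- Born rule: `prob f C ψ E` is the sum, over all sequences of outcomes of the measuring gates
of `C` whose sequence of output words lies in `E`, of the squared norm of the (unnormalized)
state reached from `ψ` along these outcomes. For a unit vector `ψ` it is the probability that
`C`, run on `ψ` with an oracle for `f`, outputs a sequence of words in `E`. -/
noncomputable def prob {N S : ℕ} (f : Fin N → Fin N) :
    Circuit N S → State S → Set (List Word) → ℝ
  | [], ψ, E => if [] ∈ E then normSq ψ else 0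
  | .unitary U :: C, ψ, E => prob f C (U.1.mulVec ψ) E
  | .query reg :: C, ψ, E => prob f C (applyOracle f reg ψ) E
  | .measure q :: C, ψ, E => ∑ b : Bool, prob f C (fun s => if s q = b then ψ s else 0) E
  | .reset q :: C, ψ, E =>
      ∑ b : Bool, prob f C (fun s => if s q = false then ψ (Function.update s q b) else 0) E
  | .output flag x₁ x₂ :: C, ψ, E =>
      ∑ v : Bool × (Fin (width N) → Bool) × (Fin (width N) → Bool),
        prob f C
          (fun s => if (s flag, (fun i => s (x₁ i)), (fun i => s (x₂ i))) = v then ψ s else 0)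
          {z | (if v.1 then some (Nat.ofBits v.2.1, Nat.ofBits v.2.2) else none) :: z ∈ E}

/-- `(a, b)` is a collision of `f`. -/
def IsCollision {N : ℕ} (f : Fin N → Fin N) (a b : Fin N) : Prop := a ≠ b ∧ f a = f b

/-- The output sequences that solve the problem of finding `K` collisions of `f`: every pair that
is output is a collision, and at least `K` different collisions (as unordered pairs, not
necessarily disjoint) are output. -/
def Solves {N : ℕ} (f : Fin N → Fin N) (K : ℕ) : Set (List Word) :=
  {z | (∀ x y : ℕ, some (x, y) ∈ z → ∃ a b : Fin N, a.val = x ∧ b.val = y ∧ IsCollision f a b) ∧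
    K ≤ {e : Sym2 (Fin N) | ∃ a b : Fin N, e = s(a, b) ∧ IsCollision f a b ∧
      some (a.val, b.val) ∈ z}.ncard}

/-- The probability that the circuit, started on `|0 ⋯ 0⟩`, finds `K` collisions in a uniformly
random function `f : [N] → [N]`. -/
noncomputable def successProb {N S : ℕ} (C : Circuit N S) (K : ℕ) : ℝ :=
  (∑ f : Fin N → Fin N, prob f C (initialState S) (Solves f K)) /
    (Fintype.card (Fin N → Fin N) : ℝ)

end CollisionSearch

namespace CollisionSearch

open scoped Matrix

/-! Fix a table size s. A head of `[N]` is cut into Bt batches of s points, and the numbers behind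
it into J disjoint blocks D of 2n points each; A is the first half of a block. For each batch the
circuit stores the s values of f and then, for each block, runs Grover search for a point of A whose
value is in the table. A cell is a pair (batch, block). Different cells yield different collisions,
so it is enough that K of the W = Bt·J ≥ 2K cells succeed.

One cell: the number of collisions between the batch and A has mean sn/N ≥ 12 and is a sum of
pairwise independent indicators, so by Chebyshev it vanishes with probability at most N/(sn) ≤ 1/12
(`card_marked_eq_empty`). Otherwise a search with a uniformly random number of iterations below m ≥
√(2n) succeeds with probability at least 1/4, however many points are marked, as long as they are at
most half of D (`le_sum_success`); marking only inside A ensures this. Nine searches all fail with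
probability at most (3/4)^9 ≤ 1/12. Since circuits are predefined, the iteration numbers are fixed
by averaging (`exists_iterations`), which leaves a failure probability of at most 1/6 per cell over
random f. The expected number of failed cells is at most W/6, and Markov's inequality gives K good
cells with probability at least 2/3; no independence between cells is needed. Wrong pairs are never
output, because the flag is set only after the value has been found in the table.

Quantum side: each search ends by measuring the query register and resetting all qubits outside the
table, hence returns to a basis state (`prob_attempt`). Between searches the algorithm is therefore
a classical random process. `Trial` and `Segment` follow it by quantifying over the remaining
circuit, so that they compose.

Cost: Bt·s + 9·Bt·J·(2m+1) queries, with Bt·J = O(K) and m = O(√(N/s)). Loading is absorbed into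
O(K√(N/s)) when s³ ≤ K²N, that is, s ≤ K^(2/3) N^(1/3); this is where the upper limit on S comes
from. Up to logarithmic factors S qubits provide such an s (`exists_table_size`). -/

/-! ### Basis states and the Born rule -/

/-- The basis state `|s⟩`. -/
noncomputable def ket {S : ℕ} (s : Fin S → Bool) : State S := Pi.single s 1

theorem ket_apply {S : ℕ} (s t : Fin S → Bool) : ket s t = if t = s then 1 else 0 := by
  simp [ket, Pi.single_apply]

theorem normSq_smul {S : ℕ} (c : ℂ) (ψ : State S) :
    normSq (c • ψ) = Complex.normSq c * normSq ψ := by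
  simp [normSq, Finset.mul_sum]

theorem normSq_ket {S : ℕ} (s : Fin S → Bool) : normSq (ket s) = 1 := by
  simp [normSq, ket_apply, apply_ite Complex.normSq]

theorem prob_nonneg {N S : ℕ} (f : Fin N → Fin N) (C : Circuit N S) :
    ∀ (ψ : State S) (E : Set (List Word)), 0 ≤ prob f C ψ E := by
  induction C with
  | nil =>
    intro ψ E
    simp only [prob]
    split_ifs
    · exact Finset.sum_nonneg fun _ _ => Complex.normSq_nonneg _
    · exact le_rfl
  | cons g C ih =>
    intro ψ E
    cases g <;> simp only [prob]
    case unitary => exact ih _ _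
    case query => exact ih _ _
    all_goals exact Finset.sum_nonneg fun _ _ => ih _ _

theorem applyOracle_smul {N S : ℕ} (f : Fin N → Fin N)
    (reg : Fin (width N) ⊕ Fin (width N) ↪ Fin S) (c : ℂ) (ψ : State S) :
    applyOracle f reg (c • ψ) = c • applyOracle f reg ψ := by
  funext s
  simp only [applyOracle, Pi.smul_apply, smul_eq_mul]
  ring

/-- Every branch of a circuit acts linearly and the final weight is quadratic. This is what turns
amplitudes left by a measurement into probabilities. -/
theorem prob_smul {N S : ℕ} (f : Fin N → Fin N) (C : Circuit N S) (c : ℂ) :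
    ∀ (ψ : State S) (E : Set (List Word)),
      prob f C (c • ψ) E = Complex.normSq c * prob f C ψ E := by
  have key : ∀ (p : (Fin S → Bool) → Prop) [DecidablePred p] (φ : State S),
      (fun s => if p s then c * φ s else 0) = c • (fun s => if p s then φ s else 0) := by
    intro p _ φ
    funext s
    simp
  induction C with
  | nil =>
    intro ψ E
    simp only [prob, normSq_smul]
    split_ifs <;> simp
  | cons g C ih =>
    intro ψ E
    cases g with
    | unitary U => simp only [prob, Matrix.mulVec_smul, ih]
    | query reg => simp only [prob, applyOracle_smul, ih]
    | measure q =>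
      simp only [prob, Finset.mul_sum, ← ih]
      refine Finset.sum_congr rfl fun b _ => ?_
      congr 1
      exact key _ _
    | reset q =>
      simp only [prob, Finset.mul_sum, ← ih]
      refine Finset.sum_congr rfl fun b _ => ?_
      congr 1
      exact key _ (fun s => ψ (Function.update s q b))
    | output flag x₁ x₂ =>
      simp only [prob, Finset.mul_sum, ← ih]
      refine Finset.sum_congr rfl fun b _ => ?_
      congr 1
      exact key _ _

theorem prob_zero {N S : ℕ} (f : Fin N → Fin N) (C : Circuit N S) (E : Set (List Word)) :
    prob f C 0 E = 0 := by
  have := prob_smul f C 0 0 E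
  simpa using this

/-- What an output gate writes in a basis state. -/
def outContent {n S : ℕ} (flag : Fin S) (x₁ x₂ : Fin n ↪ Fin S) (s : Fin S → Bool) :
    Bool × (Fin n → Bool) × (Fin n → Bool) :=
  (s flag, (fun i => s (x₁ i)), (fun i => s (x₂ i)))

/-- The output word that encodes given contents of the flag and of the registers. -/
def wordOf {n : ℕ} (v : Bool × (Fin n → Bool) × (Fin n → Bool)) : Word :=
  if v.1 then some (Nat.ofBits v.2.1, Nat.ofBits v.2.2) else none

/-- An output gate measures the registers that it copies. -/
theorem prob_output_sum {N S : ℕ} (f : Fin N → Fin N) (C : Circuit N S) {ι : Type*} [Fintype ι]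
    (flag : Fin S) (x₁ x₂ : Fin (width N) ↪ Fin S) (g : ι → ℂ) (h : ι → Fin S → Bool)
    (hinj : Function.Injective fun i => outContent flag x₁ x₂ (h i)) (E : Set (List Word)) :
    prob f (.output flag x₁ x₂ :: C) (∑ i, g i • ket (h i)) E =
      ∑ i, Complex.normSq (g i) *
        prob f C (ket (h i)) {z | wordOf (outContent flag x₁ x₂ (h i)) :: z ∈ E} := by
  classical
  have key : ∀ v : Bool × (Fin (width N) → Bool) × (Fin (width N) → Bool),
      prob f C (fun s => if (s flag, (fun i => s (x₁ i)), (fun i => s (x₂ i))) = v then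
          (∑ i, g i • ket (h i)) s else 0) {z | wordOf v :: z ∈ E} =
      ∑ i, if outContent flag x₁ x₂ (h i) = v then Complex.normSq (g i) *
        prob f C (ket (h i)) {z | wordOf v :: z ∈ E} else 0 := by
    intro v
    have hstate : (fun s => if (s flag, (fun i => s (x₁ i)), (fun i => s (x₂ i))) = v then
          (∑ i, g i • ket (h i)) s else 0) =
        ∑ i, if outContent flag x₁ x₂ (h i) = v then g i • ket (h i) else 0 := by
      funext s
      rw [Finset.sum_apply, Finset.sum_apply]
      have : ∀ i, (if outContent flag x₁ x₂ (h i) = v then g i • ket (h i) else 0) s =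
          if (s flag, (fun i => s (x₁ i)), (fun i => s (x₂ i))) = v then
            (g i • ket (h i)) s else 0 := by
        intro i
        by_cases hs : s = h i
        · subst hs
          rw [outContent]
          split_ifs <;> rfl
        · split_ifs <;> simp [ket_apply, hs]
      simp only [this]
      split_ifs
      · rfl
      · simp
    rw [hstate]
    -- By `hinj` at most one basis state survives the projection onto `v`, so there are no cross
    -- terms.
    by_cases hv : ∃ i, outContent flag x₁ x₂ (h i) = v
    · obtain ⟨i, rfl⟩ := hv
      have h1 : ∀ j, outContent flag x₁ x₂ (h j) = outContent flag x₁ x₂ (h i) ↔ j = i :=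
        fun j => ⟨fun e => hinj e, fun e => by rw [e]⟩
      simp only [h1, Finset.sum_ite_eq', Finset.mem_univ, if_true, prob_smul]
    · push Not at hv
      simp only [hv, if_false, Finset.sum_const_zero, prob_zero]
  have e1 : prob f (.output flag x₁ x₂ :: C) (∑ i, g i • ket (h i)) E =
      ∑ v : Bool × (Fin (width N) → Bool) × (Fin (width N) → Bool),
        prob f C (fun s => if (s flag, (fun i => s (x₁ i)), (fun i => s (x₂ i))) = v then
          (∑ i, g i • ket (h i)) s else 0) {z | wordOf v :: z ∈ E} := by
    simp only [prob, wordOf]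
  rw [e1]
  simp only [key]
  rw [Finset.sum_comm]
  refine Finset.sum_congr rfl fun i _ => ?_
  simp

theorem prob_reset_ket {N S : ℕ} (f : Fin N → Fin N) (C : Circuit N S) (q : Fin S)
    (s : Fin S → Bool) (E : Set (List Word)) :
    prob f (.reset q :: C) (ket s) E = prob f C (ket (Function.update s q false)) E := by
  simp only [prob]
  rw [Finset.sum_eq_single (s q)]
  · congr 1
    funext t
    have : (t q = false ∧ Function.update t q (s q) = s) ↔ t = Function.update s q false := by
      constructor
      · rintro ⟨h1, h2⟩
        rw [← h2, Function.update_idem, ← h1, Function.update_eq_self]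
      · rintro rfl
        simp
    simp only [ket_apply, ← this]
    split_ifs <;> tauto
  · intro b _ hb
    convert prob_zero f C E using 2
    funext t
    have : Function.update t q b ≠ s := by
      rintro rfl
      simp at hb
    simp [ket_apply, this]
  · simp

/-- Resetting a list of qubits. -/
theorem prob_resets_ket {N S : ℕ} (f : Fin N → Fin N) (C : Circuit N S) (l : List (Fin S))
    (E : Set (List Word)) : ∀ s : Fin S → Bool,
    prob f (l.map Gate.reset ++ C) (ket s) E =
      prob f C (ket fun i => if i ∈ l then false else s i) E := by
  induction l with
  | nil => intro s; simp
  | cons q l ih =>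
    intro s
    rw [List.map_cons, List.cons_append, prob_reset_ket, ih]
    congr 2
    funext i
    by_cases h1 : i ∈ l
    · simp [h1]
    · by_cases h2 : i = q
      · subst h2; simp
      · simp [h1, h2]

/-! ### Coherent parts of a circuit -/

/-- The linear map performed by a unitary or an oracle gate. -/
noncomputable def gateMap {N S : ℕ} (f : Fin N → Fin N) : Gate N S → (State S →ₗ[ℂ] State S)
  | .unitary U => Matrix.mulVecLin U.1
  | .query reg =>
    { toFun := applyOracle f reg
      map_add' := fun ψ φ => by
        funext s
        simp [applyOracle, mul_add]
      map_smul' := fun c ψ => applyOracle_smul f reg c ψ }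
  | _ => 0

/-- The unitary and the oracle gates. -/
def Gate.Coherent {N S : ℕ} : Gate N S → Prop
  | .unitary _ => True
  | .query _ => True
  | _ => False

/-- The linear map performed by a list of unitary and oracle gates. -/
noncomputable def runMap {N S : ℕ} (f : Fin N → Fin N) : Circuit N S → (State S →ₗ[ℂ] State S)
  | [] => LinearMap.id
  | g :: C => runMap f C ∘ₗ gateMap f g

theorem runMap_nil {N S : ℕ} (f : Fin N → Fin N) (ψ : State S) :
    runMap f ([] : Circuit N S) ψ = ψ := rfl

theorem runMap_cons {N S : ℕ} (f : Fin N → Fin N) (g : Gate N S) (C : Circuit N S)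
    (ψ : State S) : runMap f (g :: C) ψ = runMap f C (gateMap f g ψ) := rfl

theorem runMap_append {N S : ℕ} (f : Fin N → Fin N) (C C' : Circuit N S) (ψ : State S) :
    runMap f (C ++ C') ψ = runMap f C' (runMap f C ψ) := by
  induction C generalizing ψ with
  | nil => rfl
  | cons g C ih => exact ih _

/-- Coherent gates do not branch the Born sum. For the other gates `gateMap` has the meaningless
value `0`, hence the hypothesis on `C`. -/
theorem prob_coherent_append {N S : ℕ} (f : Fin N → Fin N) (C C' : Circuit N S)
    (hC : ∀ g ∈ C, g.Coherent) (E : Set (List Word)) (ψ : State S) :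
    prob f (C ++ C') ψ E = prob f C' (runMap f C ψ) E := by
  induction C generalizing ψ with
  | nil => rfl
  | cons g C ih =>
    have hg := hC g (by simp)
    have hC' : ∀ g ∈ C, g.Coherent := fun g hg => hC g (by simp [hg])
    cases g with
    | unitary U =>
      simp only [List.cons_append, prob, ih hC']
      rfl
    | query reg =>
      simp only [List.cons_append, prob, ih hC']
      rfl
    | measure q => exact hg.elim
    | reset q => exact hg.elim
    | output a b c => exact hg.elim

/-! ### Overwriting registers -/

/-- The basis state `s` with the contents of the register `r` replaced by `u`. -/
noncomputable def put {α : Type*} {S : ℕ} (r : α → Fin S) (u : α → Bool) (s : Fin S → Bool) :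
    Fin S → Bool :=
  Function.extend r u s

theorem put_apply {α : Type*} {S : ℕ} {r : α → Fin S} (hr : Function.Injective r) (u : α → Bool)
    (s : Fin S → Bool) (a : α) : put r u s (r a) = u a := hr.extend_apply u s a

theorem put_comp {α : Type*} {S : ℕ} {r : α → Fin S} (hr : Function.Injective r) (u : α → Bool)
    (s : Fin S → Bool) : (fun i => put r u s (r i)) = u := funext fun a => put_apply hr u s a

theorem put_apply_of_notMem {α : Type*} {S : ℕ} {r : α → Fin S} (u : α → Bool)
    (s : Fin S → Bool) {i : Fin S} (hi : ∀ a, r a ≠ i) : put r u s i = s i :=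
  Function.extend_apply' u s i (by simpa using hi)

theorem put_put {α : Type*} {S : ℕ} {r : α → Fin S} (hr : Function.Injective r) (u v : α → Bool)
    (s : Fin S → Bool) : put r u (put r v s) = put r u s := by
  funext i
  by_cases h : ∃ a, r a = i
  · obtain ⟨a, rfl⟩ := h
    rw [put_apply hr, put_apply hr]
  · push Not at h
    simp only [put_apply_of_notMem _ _ h]

theorem put_self {α : Type*} {S : ℕ} {r : α → Fin S} (hr : Function.Injective r)
    (s : Fin S → Bool) : put r (fun a => s (r a)) s = s := by
  funext i
  by_cases h : ∃ a, r a = i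
  · obtain ⟨a, rfl⟩ := h
    rw [put_apply hr]
  · push Not at h
    rw [put_apply_of_notMem _ _ h]

/-! ### Unitary gates -/

theorem mulVec_ket {S : ℕ} (M : Matrix (Fin S → Bool) (Fin S → Bool) ℂ) (s : Fin S → Bool) :
    M *ᵥ ket s = fun t => M t s := by
  funext t
  simp [ket]

/-- A permutation of the basis states together with phases. -/
noncomputable def monomialUnitary {S : ℕ} (σ : Equiv.Perm (Fin S → Bool)) (c : (Fin S → Bool) → ℂ)
    (hc : ∀ s, star (c s) * c s = 1) : Matrix.unitaryGroup (Fin S → Bool) ℂ :=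
  ⟨Matrix.of fun t s => if t = σ s then c s else 0, by
    rw [Matrix.mem_unitaryGroup_iff']
    ext s s'
    rw [Matrix.mul_apply, Finset.sum_eq_single (σ s)]
    · by_cases h : s = s'
      · subst h
        simpa [Matrix.star_apply] using hc s
      · simp [h]
    · intro t _ ht
      simp [Matrix.star_apply, ht]
    · simp⟩

theorem monomialUnitary_ket {S : ℕ} (σ : Equiv.Perm (Fin S → Bool)) (c : (Fin S → Bool) → ℂ)
    (hc : ∀ s, star (c s) * c s = 1) (s : Fin S → Bool) :
    (monomialUnitary σ c hc).1 *ᵥ ket s = c s • ket (σ s) := by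
  rw [mulVec_ket]
  funext t
  simp [monomialUnitary, ket_apply]

/-- The bitwise exclusive or of a register with a function of the other qubits. -/
noncomputable def xorWrite {α : Type*} {S : ℕ} (r : α → Fin S) (hr : Function.Injective r)
    (φ : (Fin S → Bool) → α → Bool) (hφ : ∀ u s, φ (put r u s) = φ s) :
    Equiv.Perm (Fin S → Bool) :=
  Function.Involutive.toPerm (fun s => put r (fun a => xor (s (r a)) (φ s a)) s) (by
    intro s
    simp only [put_put hr, hφ, put_apply hr, Bool.xor_assoc, Bool.xor_self, Bool.xor_false]
    exact put_self hr s)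

theorem xorWrite_apply {α : Type*} {S : ℕ} (r : α → Fin S) (hr : Function.Injective r)
    (φ : (Fin S → Bool) → α → Bool) (hφ : ∀ u s, φ (put r u s) = φ s) (s : Fin S → Bool)
    (hs : ∀ a, s (r a) = false) : xorWrite r hr φ hφ s = put r (φ s) s := by
  change put r (fun a => xor (s (r a)) (φ s a)) s = _
  simp [hs]

/-- The unitary `V` on the register `r`. -/
noncomputable def regMatrix {n S : ℕ} (r : Fin n ↪ Fin S) (V : Matrix (Fin n → Bool) (Fin n → Bool) ℂ) :
    Matrix (Fin S → Bool) (Fin S → Bool) ℂ :=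
  Matrix.of fun t s => if t = put r (fun a => t (r a)) s then
    V (fun a => t (r a)) (fun a => s (r a)) else 0

theorem regMatrix_ket {n S : ℕ} (r : Fin n ↪ Fin S) (V : Matrix (Fin n → Bool) (Fin n → Bool) ℂ)
    (s : Fin S → Bool) :
    regMatrix r V *ᵥ ket s = ∑ u, V u (fun a => s (r a)) • ket (put r u s) := by
  rw [mulVec_ket]
  funext t
  rw [Finset.sum_apply, Finset.sum_eq_single (fun a => t (r a))]
  · simp [regMatrix, ket_apply]
  · intro u _ hu
    have : t ≠ put r u s := by
      rintro rfl
      exact hu (put_comp r.injective u s).symm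
    simp [ket_apply, this]
  · simp

theorem regMatrix_mem {n S : ℕ} (r : Fin n ↪ Fin S) (V : Matrix.unitaryGroup (Fin n → Bool) ℂ) :
    regMatrix r V.1 ∈ Matrix.unitaryGroup (Fin S → Bool) ℂ := by
  rw [Matrix.mem_unitaryGroup_iff']
  have hV : ∀ u v, ∑ w, star (V.1 w u) * V.1 w v = if u = v then 1 else 0 := by
    intro u v
    have := congrFun (congrFun (Matrix.mem_unitaryGroup_iff'.1 V.2) u) v
    rw [Matrix.mul_apply, Matrix.one_apply] at this
    simpa only [Matrix.star_apply] using this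
  ext s s'
  rw [Matrix.mul_apply]
  have key := congrArg (fun ψ : State S => ∑ t, star (regMatrix r V.1 t s) * ψ t)
    (regMatrix_ket r V.1 s')
  rw [mulVec_ket] at key
  simp only [Matrix.star_apply]
  rw [key]
  simp only [Finset.sum_apply, Pi.smul_apply, ket_apply, smul_eq_mul, mul_ite, mul_one, mul_zero,
    Finset.mul_sum]
  rw [Finset.sum_comm]
  simp only [Finset.sum_ite_eq', Finset.mem_univ, if_true]
  have h1 : ∀ u, regMatrix r V.1 (put r u s') s =
      if put r u s' = put r u s then V.1 u (fun a => s (r a)) else 0 := by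
    intro u
    simp only [regMatrix, Matrix.of_apply, put_comp r.injective]
  simp only [h1]
  rw [Matrix.one_apply]
  -- Two columns overlap only if `s` and `s'` agree off the register; in that case unitarity of `V`
  -- decides.
  by_cases hss : ∃ u, put r u s' = put r u s
  · obtain ⟨u₀, hu₀⟩ := hss
    have hall : ∀ u, put r u s' = put r u s := by
      intro u
      rw [← put_put r.injective u u₀ s', hu₀, put_put r.injective]
    simp only [hall, if_true, hV]
    congr 1
    apply propext
    constructor
    · intro h
      have := hall (fun a => s (r a))
      rw [put_self r.injective, h, put_self r.injective] at this
      exact this.symm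
    · rintro rfl; rfl
  · push Not at hss
    have : s ≠ s' := by
      rintro rfl
      exact hss (fun _ => false) rfl
    simp [hss, this]

/-! ### Binary encodings -/

/-- The binary encoding of an element of `[N]`. -/
def enc {N : ℕ} (a : Fin N) : Fin (width N) → Bool := fun i => a.val.testBit i

theorem ofBits_enc {N : ℕ} (a : Fin N) : Nat.ofBits (enc a) = a.val := by
  unfold enc
  rw [Nat.ofBits_testBit]
  exact Nat.mod_eq_of_lt (a.2.trans_le (Nat.le_pow_clog (by norm_num) N))

theorem enc_injective {N : ℕ} : Function.Injective (enc (N := N)) := fun a b h =>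
  Fin.ext (by rw [← ofBits_enc a, ← ofBits_enc b, h])

theorem enc_ofBits {N : ℕ} (u : Fin (width N) → Bool) (h : Nat.ofBits u < N) :
    enc ⟨Nat.ofBits u, h⟩ = u := by
  funext i
  exact Nat.testBit_ofBits_lt u i i.2

theorem enc_zero {N : ℕ} [NeZero N] : enc (0 : Fin N) = fun _ => false := by
  funext i
  simp [enc]

/-- Unless `N` is a power of two, some bit strings encode no element of `[N]`; this discards them.
-/
theorem sum_bits {N : ℕ} {M : Type*} [AddCommMonoid M] (F : (Fin (width N) → Bool) → M)
    (hF : ∀ u, N ≤ Nat.ofBits u → F u = 0) : ∑ u, F u = ∑ y : Fin N, F (enc y) := by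
  symm
  refine Finset.sum_of_injOn enc enc_injective.injOn (by simp) ?_ (by simp)
  intro u _ hu
  refine hF u (not_lt.1 fun h => hu ?_)
  exact ⟨⟨_, h⟩, by simp, enc_ofBits u h⟩

/-! ### The discrete Fourier transform modulo `N` -/

/-- The root of unity `exp (2 π i / N)`. -/
noncomputable def omega (N : ℕ) : ℂ := Complex.exp (2 * Real.pi * Complex.I / N)

theorem star_omega_mul (N : ℕ) : star (omega N) * omega N = 1 := by
  have h : ‖omega N‖ = 1 := by
    have : 2 * Real.pi * Complex.I / N = ((2 * Real.pi / N : ℝ) : ℂ) * Complex.I := by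
      push_cast
      ring
    rw [omega, this, Complex.norm_exp_ofReal_mul_I]
  have := Complex.conj_mul' (omega N)
  rw [h] at this
  simpa using this

/-- The Fourier transform of `ℤ / N`, extended by the identity. -/
noncomputable def dftMatrix (N : ℕ) : Matrix (Fin (width N) → Bool) (Fin (width N) → Bool) ℂ :=
  Matrix.of fun u v => if Nat.ofBits u < N ∧ Nat.ofBits v < N then
    ((1 / Real.sqrt N : ℝ) : ℂ) * omega N ^ (Nat.ofBits u * Nat.ofBits v)
  else if u = v then 1 else 0

/-- A geometric sum whose ratio `ζ` is an `N`-th root of unity, equal to `1` only for `a = b` by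
primitivity of `omega N`. -/
theorem sum_omega {N : ℕ} [NeZero N] (a b : Fin N) :
    ∑ c : Fin N, star (omega N ^ (c.val * a.val)) * omega N ^ (c.val * b.val) =
      if a = b then (N : ℂ) else 0 := by
  have hprim : IsPrimitiveRoot (omega N) N := Complex.isPrimitiveRoot_exp N (NeZero.ne N)
  have hne : omega N ≠ 0 := Complex.exp_ne_zero _
  set ζ : ℂ := star (omega N) ^ a.val * omega N ^ b.val with hζ
  have h1 : ∀ c : Fin N, star (omega N ^ (c.val * a.val)) * omega N ^ (c.val * b.val) =
      ζ ^ c.val := by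
    intro c
    rw [hζ, mul_pow, ← pow_mul, ← pow_mul, star_pow, mul_comm a.val, mul_comm b.val]
  simp only [h1]
  rw [Fin.sum_univ_eq_sum_range (fun c => ζ ^ c) N]
  split_ifs with hab
  · subst hab
    rw [hζ, ← mul_pow, star_omega_mul]
    simp
  · have hζ1 : ζ ≠ 1 := by
      intro h
      apply hab
      have h2 : omega N ^ b.val = omega N ^ a.val := by
        calc omega N ^ b.val = (star (omega N) * omega N) ^ a.val * omega N ^ b.val := by
              rw [star_omega_mul]; simp
          _ = ζ * omega N ^ a.val := by rw [hζ, mul_pow]; ring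
          _ = _ := by rw [h, one_mul]
      exact (Fin.ext (hprim.pow_inj b.2 a.2 h2)).symm
    have hN : ζ ^ N = 1 := by
      rw [hζ, mul_pow, ← pow_mul, ← pow_mul, mul_comm a.val, mul_comm b.val, pow_mul, pow_mul,
        ← star_pow, hprim.pow_eq_one]
      simp
    have := mul_neg_geom_sum ζ N
    rw [hN, sub_self] at this
    rcases mul_eq_zero.1 this with h | h
    · exact absurd (sub_eq_zero.1 h).symm hζ1
    · exact h

theorem dftMatrix_mem (N : ℕ) [NeZero N] :
    dftMatrix N ∈ Matrix.unitaryGroup (Fin (width N) → Bool) ℂ := by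
  rw [Matrix.mem_unitaryGroup_iff']
  ext u v
  rw [Matrix.mul_apply]
  simp only [Matrix.star_apply]
  have hcol : ∀ w v : Fin (width N) → Bool, N ≤ Nat.ofBits v →
      dftMatrix N w v = if w = v then 1 else 0 := by
    intro w v hv
    simp [dftMatrix, hv.not_gt]
  have hrow : ∀ w v : Fin (width N) → Bool, N ≤ Nat.ofBits w →
      dftMatrix N w v = if w = v then 1 else 0 := by
    intro w v hv
    simp [dftMatrix, hv.not_gt]
  by_cases hu : N ≤ Nat.ofBits u
  · simp only [hcol _ u hu]
    simp [hrow u v hu, Matrix.one_apply, apply_ite (starRingEnd ℂ)]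
  by_cases hv : N ≤ Nat.ofBits v
  · simp only [hcol _ v hv]
    simp only [mul_ite, mul_one, mul_zero, Finset.sum_ite_eq', Finset.mem_univ, if_true]
    rw [hrow v u hv, Matrix.one_apply]
    simp [eq_comm, apply_ite (starRingEnd ℂ)]
  push Not at hu hv
  obtain ⟨a, rfl⟩ : ∃ a : Fin N, u = enc a := ⟨_, (enc_ofBits u hu).symm⟩
  obtain ⟨b, rfl⟩ : ∃ a : Fin N, v = enc a := ⟨_, (enc_ofBits v hv).symm⟩
  rw [sum_bits]
  · simp only [dftMatrix, Matrix.of_apply, ofBits_enc, Fin.is_lt, and_self, if_true]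
    have : ∀ c : Fin N, star (((1 / Real.sqrt N : ℝ) : ℂ) * omega N ^ (c.val * a.val)) *
        (((1 / Real.sqrt N : ℝ) : ℂ) * omega N ^ (c.val * b.val)) =
        ((1 / Real.sqrt N * (1 / Real.sqrt N) : ℝ) : ℂ) *
          (star (omega N ^ (c.val * a.val)) * omega N ^ (c.val * b.val)) := by
      intro c
      have : star ((1 / Real.sqrt N : ℝ) : ℂ) = ((1 / Real.sqrt N : ℝ) : ℂ) :=
        Complex.conj_ofReal _
      rw [star_mul, this]
      push_cast
      ring
    simp only [this, ← Finset.mul_sum]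
    rw [sum_omega, Matrix.one_apply]
    have hN : (N : ℝ) ≠ 0 := Nat.cast_ne_zero.2 (NeZero.ne N)
    have h2 : (1 / Real.sqrt N * (1 / Real.sqrt N) : ℝ) = 1 / N := by
      rw [div_mul_div_comm, one_mul, Real.mul_self_sqrt (Nat.cast_nonneg N)]
    rw [h2]
    by_cases hab : a = b
    · subst hab
      have : (N : ℂ) ≠ 0 := Nat.cast_ne_zero.2 (NeZero.ne N)
      simp [this]
    · simp [hab, enc_injective.eq_iff]
  · intro w hw
    rw [hrow _ _ hw, if_neg]
    · simp
    · rintro rfl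
      omega

/-- The Fourier transform as an element of the unitary group. -/
noncomputable def dft (N : ℕ) [NeZero N] : Matrix.unitaryGroup (Fin (width N) → Bool) ℂ :=
  ⟨dftMatrix N, dftMatrix_mem N⟩

/-- The phase oracle turns the Fourier transform of `|0⟩` into that of `|f y⟩`, so conjugation by
the transform writes `f y` into the phase register. -/
theorem dft_zero_mul_phase {N : ℕ} [NeZero N] (f : Fin N → Fin N) (y : Fin N)
    (u : Fin (width N) → Bool) :
    (dft N).1 u (enc 0) * oraclePhase f y (Nat.ofBits u) = (dft N).1 u (enc (f y)) := by
  by_cases hu : Nat.ofBits u < N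
  · simp [dft, dftMatrix, oraclePhase, hu, ofBits_enc, omega, NeZero.pos N]
  · have hne : ∀ a : Fin N, u ≠ enc a := by
      rintro a rfl
      exact hu (by rw [ofBits_enc]; exact a.2)
    simp [dft, dftMatrix, hu, hne]

/-- With the conjugate transform the same oracle cancels the phase of `f y`, so erasing the value
needs no inverse oracle. -/
theorem star_dft_mul_phase {N : ℕ} [NeZero N] (f : Fin N → Fin N) (y : Fin N)
    (u : Fin (width N) → Bool) :
    (star (dft N)).1 u (enc (f y)) * oraclePhase f y (Nat.ofBits u) =
      (star (dft N)).1 u (enc 0) := by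
  have hstar : ∀ u v, (star (dft N)).1 u v = star ((dft N).1 v u) := fun u v => rfl
  rw [hstar, hstar]
  by_cases hu : Nat.ofBits u < N
  · have h1 : ((starRingEnd ℂ) (omega N) * omega N) = 1 := star_omega_mul N
    have h2 : oraclePhase f y (Nat.ofBits u) = omega N ^ ((f y).val * Nat.ofBits u) := by
      simp [oraclePhase, hu, omega, mul_comm]
    rw [h2]
    simp only [dft, dftMatrix, Matrix.of_apply, ofBits_enc, hu, Fin.is_lt, and_self, if_true,
      star_mul', star_pow]
    rw [mul_assoc, ← mul_pow, star_omega_mul]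
    simp
  · have hne : ∀ a : Fin N, enc a ≠ u := by
      rintro a rfl
      exact hu (by rw [ofBits_enc]; exact a.2)
    simp [dft, dftMatrix, hu, hne]

/-! ### Reflections -/

/-- The extension by `0` of a vector indexed by `[N]` to all bit strings. -/
noncomputable def extendBits {N : ℕ} (v : Fin N → ℝ) (u : Fin (width N) → Bool) : ℝ :=
  if h : Nat.ofBits u < N then v ⟨_, h⟩ else 0

theorem extendBits_enc {N : ℕ} (v : Fin N → ℝ) (y : Fin N) : extendBits v (enc y) = v y := by
  simp [extendBits, ofBits_enc]

theorem extendBits_of_le {N : ℕ} (v : Fin N → ℝ) (u : Fin (width N) → Bool)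
    (h : N ≤ Nat.ofBits u) : extendBits v u = 0 := by
  simp [extendBits, h.not_gt]

/-- The reflection `1 - c v vᵀ`. -/
noncomputable def reflection {N : ℕ} (v : Fin N → ℝ) (c : ℝ) (hc : c * ∑ y, v y ^ 2 = 2) :
    Matrix.unitaryGroup (Fin (width N) → Bool) ℂ :=
  ⟨Matrix.of fun a b => (((if a = b then 1 else 0) - c * extendBits v a * extendBits v b : ℝ) : ℂ),
    by
      have hsum : ∑ u, extendBits v u ^ 2 = ∑ y, v y ^ 2 := by
        rw [sum_bits]
        · simp only [extendBits_enc]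
        · intro u hu
          simp [extendBits_of_le v u hu]
      rw [Matrix.mem_unitaryGroup_iff']
      ext a b
      rw [Matrix.mul_apply]
      simp only [Matrix.star_apply, Matrix.of_apply]
      have h1 : ∀ r : ℝ, star (r : ℂ) = r := fun r => Complex.conj_ofReal r
      simp only [h1]
      simp only [← Complex.ofReal_mul, ← Complex.ofReal_sum]
      rw [Matrix.one_apply]
      -- The square of `1 - c v vᵀ` is `1 - 2c v vᵀ + c²‖v‖² v vᵀ`; the last two terms cancel
      -- because `c‖v‖² = 2`.
      have : ∑ w, ((if w = a then 1 else 0) - c * extendBits v w * extendBits v a) *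
          ((if w = b then 1 else 0) - c * extendBits v w * extendBits v b) =
          ((if a = b then 1 else 0 : ℝ) - 2 * (c * extendBits v a * extendBits v b)) +
            c * extendBits v a * extendBits v b * (c * ∑ u, extendBits v u ^ 2) := by
        have h2 : ∀ w, ((if w = a then 1 else 0) - c * extendBits v w * extendBits v a) *
          ((if w = b then 1 else 0) - c * extendBits v w * extendBits v b) =
          (if w = a then ((if w = b then 1 else 0 : ℝ) - c * extendBits v w * extendBits v b)
            else 0) - (if w = b then c * extendBits v w * extendBits v a else 0) +
            c * extendBits v a * extendBits v b * (c * extendBits v w ^ 2) := by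
          intro w
          split_ifs <;> ring
        simp only [h2, Finset.sum_add_distrib, Finset.sum_sub_distrib, Finset.sum_ite_eq',
          Finset.mem_univ, if_true, ← Finset.mul_sum]
        ring
      rw [this, hsum, hc]
      have h3 : ((if a = b then 1 else 0 : ℝ) - 2 * (c * extendBits v a * extendBits v b)) +
            c * extendBits v a * extendBits v b * 2 = if a = b then 1 else 0 := by ring
      rw [h3]
      split_ifs <;> simp⟩

/-! ### Layout of the memory -/

/-- The qubits in use: a query register, a phase register, a register for the other half of a
collision, a flag, and a table with `s` entries. -/
abbrev Reg (w s : ℕ) : Type := (Fin w ⊕ Fin w) ⊕ (Fin w ⊕ Unit ⊕ Fin s × Fin w)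

section Layout

variable {w s S : ℕ} (L : Reg w s ↪ Fin S)

/-- The query register. -/
def queryReg : Fin w ↪ Fin S := ⟨fun i => L (.inl (.inl i)), fun i j h => by simpa using h⟩

/-- The phase register. -/
def phaseReg : Fin w ↪ Fin S := ⟨fun i => L (.inl (.inr i)), fun i j h => by simpa using h⟩

/-- The register for the other half of a collision. -/
def matchReg : Fin w ↪ Fin S := ⟨fun i => L (.inr (.inl i)), fun i j h => by simpa using h⟩

/-- The flag. -/
def flagQubit : Fin S := L (.inr (.inr (.inl ())))

/-- The position of the register for the other half of a collision, together with the flag. -/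
def resultIndex : Fin w ⊕ Unit → Reg w s :=
  Sum.elim (fun i => .inr (.inl i)) fun _ => .inr (.inr (.inl ()))

theorem resultIndex_injective : Function.Injective (resultIndex (w := w) (s := s)) := by
  rintro (i | i) (j | j) h <;> simp_all [resultIndex]

/-- The register for the other half of a collision, together with the flag. -/
def resultReg : Fin w ⊕ Unit ↪ Fin S :=
  ⟨fun i => L (resultIndex i), L.injective.comp resultIndex_injective⟩

/-- An entry of the table. -/
def slotReg (k : Fin s) : Fin w ↪ Fin S :=
  ⟨fun i => L (.inr (.inr (.inr (k, i)))), fun i j h => by simpa using h⟩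

/-- The contents of all qubits in use. -/
def content (y p x : Fin w → Bool) (b : Bool) (T : Fin s → Fin w → Bool) : Reg w s → Bool :=
  Sum.elim (Sum.elim y p) (Sum.elim x (Sum.elim (fun _ => b) fun k => T k.1 k.2))

/-- The basis state with given contents of the registers. -/
noncomputable def conf (y p x : Fin w → Bool) (b : Bool) (T : Fin s → Fin w → Bool) :
    Fin S → Bool :=
  put L (content y p x b T) fun _ => false

variable (y p x u : Fin w → Bool) (b : Bool) (T : Fin s → Fin w → Bool)

theorem conf_apply (a : Reg w s) : conf L y p x b T (L a) = content y p x b T a :=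
  put_apply L.injective _ _ _

theorem conf_queryReg : (fun i => conf L y p x b T (queryReg L i)) = y :=
  funext fun _ => conf_apply L y p x b T _

theorem conf_phaseReg : (fun i => conf L y p x b T (phaseReg L i)) = p :=
  funext fun _ => conf_apply L y p x b T _

theorem conf_matchReg : (fun i => conf L y p x b T (matchReg L i)) = x :=
  funext fun _ => conf_apply L y p x b T _

theorem conf_flagQubit : conf L y p x b T (flagQubit L) = b := conf_apply L y p x b T _

theorem conf_slotReg : (fun k i => conf L y p x b T (slotReg L k i)) = T :=
  funext fun _ => funext fun _ => conf_apply L y p x b T _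

theorem put_put_subreg {α : Type*} (ι : α → Reg w s) (hι : Function.Injective ι) (v : α → Bool)
    (c c' : Reg w s → Bool) (σ : Fin S → Bool) (h1 : ∀ a, c' (ι a) = v a)
    (h2 : ∀ i, (∀ a, ι a ≠ i) → c' i = c i) :
    put (fun a => L (ι a)) v (put L c σ) = put L c' σ := by
  have hinj : Function.Injective fun a => L (ι a) := L.injective.comp hι
  funext i
  by_cases h : ∃ a, L a = i
  · obtain ⟨i, rfl⟩ := h
    rw [put_apply L.injective]
    by_cases h' : ∃ a, ι a = i
    · obtain ⟨a, rfl⟩ := h'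
      exact (put_apply hinj v _ a).trans (h1 a).symm
    · push Not at h'
      rw [put_apply_of_notMem, put_apply L.injective, h2 i h']
      intro a ha
      exact h' a (L.injective ha)
  · push Not at h
    rw [put_apply_of_notMem, put_apply_of_notMem _ _ h, put_apply_of_notMem _ _ h]
    exact fun a => h _

theorem put_queryReg : put (queryReg L) u (conf L y p x b T) = conf L u p x b T := by
  refine put_put_subreg L (fun i => .inl (.inl i)) (fun i j h => by simpa using h) _ _ _ _
    (fun _ => rfl) ?_
  rintro ((i | i) | (i | i | i)) h <;> first | rfl | exact absurd rfl (h i)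

theorem put_phaseReg : put (phaseReg L) u (conf L y p x b T) = conf L y u x b T := by
  refine put_put_subreg L (fun i => .inl (.inr i)) (fun i j h => by simpa using h) _ _ _ _
    (fun _ => rfl) ?_
  rintro ((i | i) | (i | i | i)) h <;> first | rfl | exact absurd rfl (h i)

theorem put_resultReg (b' : Bool) :
    put (resultReg L) (Sum.elim u fun _ => b') (conf L y p x b T) = conf L y p u b' T := by
  refine put_put_subreg L resultIndex resultIndex_injective _ _ _ _ ?_ ?_
  · rintro (i | i) <;> rfl
  · rintro ((i | i) | (i | i | i)) h <;>
      first | rfl | exact absurd rfl (h (.inl i)) | exact absurd rfl (h (.inr i))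

theorem put_slotReg (k : Fin s) :
    put (slotReg L k) u (conf L y p x b T) = conf L y p x b (Function.update T k u) := by
  refine put_put_subreg L (fun i => .inr (.inr (.inr (k, i)))) (fun i j h => by simpa using h)
    _ _ _ _ (fun _ => by simp [content]) ?_
  rintro ((i | i) | (i | i | ⟨k', i⟩)) h <;> try rfl
  have : k' ≠ k := by
    rintro rfl
    exact h i rfl
  simp [content, this]

theorem put_resultReg_other (v : Fin w ⊕ Unit → Bool) (σ : Fin S → Bool) (a : Reg w s)
    (ha : ∀ i, resultIndex i ≠ a) :
    put (resultReg L) v σ (L a) = σ (L a) :=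
  put_apply_of_notMem _ _ fun i hi => ha i (L.injective hi)

/-- The basis state in which only the table has been written. -/
noncomputable def base : Fin S → Bool := conf L (fun _ => false) (fun _ => false)
  (fun _ => false) false T

open Classical in
/-- The qubits outside of the table. -/
noncomputable def workQubits : List (Fin S) :=
  (Finset.univ.filter fun i => ∀ a, L (.inr (.inr (.inr a))) ≠ i).toList

theorem reset_workQubits :
    (fun i => if i ∈ workQubits L then false else conf L y p x b T i) = base L T := by
  classical
  funext i
  by_cases h : ∃ a, L a = i
  · obtain ⟨a, rfl⟩ := h
    rw [base, conf_apply, conf_apply]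
    rcases a with ((i | i) | (i | i | i)) <;> simp [workQubits, content]
  · push Not at h
    rw [base, conf, conf, put_apply_of_notMem _ _ h, put_apply_of_notMem _ _ h]
    simp

end Layout

/-! ### Grover amplitudes -/

/-- The uniform superposition over `D`. -/
noncomputable def unif {N : ℕ} (D : Finset (Fin N)) (y : Fin N) : ℝ :=
  if y ∈ D then 1 / Real.sqrt D.card else 0

/-- The change of sign of the amplitudes of `M`. -/
def flipSign {N : ℕ} (M : Finset (Fin N)) (g : Fin N → ℝ) (y : Fin N) : ℝ :=
  if y ∈ M then -g y else g y

/-- The amplitudes after `j` Grover iterations on `D` with marked elements `M`. -/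
noncomputable def amp {N : ℕ} (D M : Finset (Fin N)) : ℕ → Fin N → ℝ
  | 0 => unif D
  | j + 1 => fun y => flipSign M (amp D M j) y -
      2 * unif D y * ∑ z, unif D z * flipSign M (amp D M j) z

theorem sum_unif_sq {N : ℕ} {D : Finset (Fin N)} (hD : D.Nonempty) : ∑ y, unif D y ^ 2 = 1 := by
  have h : (0 : ℝ) < D.card := Nat.cast_pos.2 hD.card_pos
  simp [unif, ite_pow, Finset.sum_ite_mem, h.ne']

theorem two_mul_sum_unif_sq {N : ℕ} {D : Finset (Fin N)} (hD : D.Nonempty) :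
    2 * ∑ y, unif D y ^ 2 = 2 := by
  rw [sum_unif_sq hD, mul_one]

/-- The direction of the reflection that takes `|0⟩` to the uniform superposition over `D`. -/
noncomputable def prepVector {N : ℕ} [NeZero N] (D : Finset (Fin N)) (y : Fin N) : ℝ :=
  unif D y - if y = 0 then 1 else 0

/-- As `0 ∉ D`, the difference is one of two orthogonal unit vectors; the reflection along it
exchanges them. -/
theorem one_mul_sum_prepVector_sq {N : ℕ} [NeZero N] {D : Finset (Fin N)} (hD : D.Nonempty)
    (h0 : (0 : Fin N) ∉ D) : 1 * ∑ y, prepVector D y ^ 2 = 2 := by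
  have h : ∀ y, prepVector D y ^ 2 = unif D y ^ 2 + if y = 0 then 1 else 0 := by
    intro y
    by_cases hy : y = 0
    · subst hy
      simp [prepVector, unif, h0]
    · simp [prepVector, hy]
  simp only [h, Finset.sum_add_distrib, sum_unif_sq hD]
  norm_num

theorem sum_flipSign_sq {N : ℕ} (M : Finset (Fin N)) (g : Fin N → ℝ) :
    ∑ y, flipSign M g y ^ 2 = ∑ y, g y ^ 2 := by
  refine Finset.sum_congr rfl fun y _ => ?_
  unfold flipSign
  split_ifs <;> ring

theorem sum_amp_sq {N : ℕ} {D : Finset (Fin N)} (hD : D.Nonempty) (M : Finset (Fin N)) (j : ℕ) :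
    ∑ y, amp D M j y ^ 2 = 1 := by
  induction j with
  | zero => exact sum_unif_sq hD
  | succ j ih =>
    rw [← sum_flipSign_sq M] at ih
    set h := flipSign M (amp D M j) with hh
    set I := ∑ z, unif D z * h z with hI
    have : ∀ y, amp D M (j + 1) y ^ 2 =
        h y ^ 2 - 4 * I * (unif D y * h y) + 4 * I ^ 2 * unif D y ^ 2 := by
      intro y
      simp only [amp, ← hh, ← hI]
      ring
    simp only [this, Finset.sum_add_distrib, Finset.sum_sub_distrib, ← Finset.mul_sum, ← hI, ih,
      sum_unif_sq hD]
    ring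

/-! ### One run of Grover's algorithm -/

section Attempt

variable {N s S : ℕ} [NeZero N] (L : Reg (width N) s ↪ Fin S)

/-- The registers to which the oracle is applied. -/
def oracleReg : Fin (width N) ⊕ Fin (width N) ↪ Fin S :=
  ⟨fun i => L (.inl i), fun i j h => by simpa using h⟩

/-- A unitary gate on one register. -/
noncomputable def regGate (r : Fin (width N) ↪ Fin S)
    (V : Matrix.unitaryGroup (Fin (width N) → Bool) ℂ) : Gate N S :=
  .unitary ⟨regMatrix r V.1, regMatrix_mem r V⟩

/-- Writes `f y` into the phase register, where `y` is held in the query register. -/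
noncomputable def compute : Circuit N S :=
  [regGate (phaseReg L) (dft N), .query (oracleReg L), regGate (phaseReg L) (star (dft N))]

/-- Erases `f y` from the phase register. -/
noncomputable def uncompute : Circuit N S :=
  [regGate (phaseReg L) (star (dft N)), .query (oracleReg L), regGate (phaseReg L) (dft N)]

variable (f : Fin N → Fin N) (y z : Fin N) (p x u : Fin (width N) → Bool) (b : Bool)
  (T : Fin s → Fin (width N) → Bool)

omit [NeZero N] in
theorem gateMap_query_ket :
    gateMap f (.query (oracleReg L)) (ket (conf L (enc y) p x b T)) =
      oraclePhase f y (Nat.ofBits p) • ket (conf L (enc y) p x b T) := by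
  funext t
  change oraclePhase f _ _ * ket (conf L (enc y) p x b T) t = _
  rw [Pi.smul_apply, smul_eq_mul, ket_apply]
  split_ifs with h
  · subst h
    have h1 : readReg (fun i => oracleReg L (Sum.inl i)) (conf L (enc y) p x b T) = y := by
      rw [← ofBits_enc y]
      exact congrArg Nat.ofBits (conf_queryReg L (enc y) p x b T)
    have h2 : readReg (fun i => oracleReg L (Sum.inr i)) (conf L (enc y) p x b T) =
        Nat.ofBits p := congrArg Nat.ofBits (conf_phaseReg L (enc y) p x b T)
    rw [h1, h2]
  · simp

omit [NeZero N] in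
theorem gateMap_regGate_ket (r : Fin (width N) ↪ Fin S)
    (V : Matrix.unitaryGroup (Fin (width N) → Bool) ℂ) (σ : Fin S → Bool) :
    gateMap f (regGate r V) (ket σ) = ∑ u, V.1 u (fun a => σ (r a)) • ket (put r u σ) :=
  regMatrix_ket r V.1 σ

omit [NeZero N] in
theorem gateMap_phase_ket (V : Matrix.unitaryGroup (Fin (width N) → Bool) ℂ)
    (q : Fin (width N) → Bool) :
    gateMap f (regGate (phaseReg L) V) (ket (conf L q p x b T)) =
      ∑ u, V.1 u p • ket (conf L q u x b T) := by
  rw [gateMap_regGate_ket]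
  simp only [conf_phaseReg, put_phaseReg]

omit [NeZero N] in
theorem gateMap_phase_inv (V W : Matrix.unitaryGroup (Fin (width N) → Bool) ℂ) (h : V * W = 1)
    (q : Fin (width N) → Bool) :
    gateMap f (regGate (phaseReg L) V) (∑ u, W.1 u p • ket (conf L q u x b T)) =
      ket (conf L q p x b T) := by
  simp only [map_sum, map_smul, gateMap_phase_ket, Finset.smul_sum, smul_smul]
  rw [Finset.sum_comm]
  simp only [← Finset.sum_smul]
  have h1 : ∀ v, ∑ u, W.1 u p * V.1 v u = if v = p then 1 else 0 := by
    intro v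
    have := congrFun (congrFun (congrArg Subtype.val h) v) p
    rw [Submonoid.coe_mul, Matrix.mul_apply] at this
    simp only [mul_comm (W.1 _ _)]
    rw [this]
    exact Matrix.one_apply
  simp [h1]

theorem runMap_compute : runMap f (compute L) (ket (conf L (enc y) (enc 0) x b T)) =
    ket (conf L (enc y) (enc (f y)) x b T) := by
  rw [compute, runMap_cons, runMap_cons, runMap_cons, runMap_nil, gateMap_phase_ket]
  simp only [map_sum, map_smul, gateMap_query_ket, smul_smul, dft_zero_mul_phase]
  rw [← gateMap_phase_inv L f (enc (f y)) x b T (star (dft N)) (dft N)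
    (Unitary.star_mul_self (dft N))]
  simp only [map_sum, map_smul]

theorem runMap_uncompute : runMap f (uncompute L) (ket (conf L (enc y) (enc (f y)) x b T)) =
    ket (conf L (enc y) (enc 0) x b T) := by
  rw [uncompute, runMap_cons, runMap_cons, runMap_cons, runMap_nil, gateMap_phase_ket]
  simp only [map_sum, map_smul, gateMap_query_ket, smul_smul, star_dft_mul_phase]
  rw [← gateMap_phase_inv L f (enc 0) x b T (dft N) (star (dft N))
    (Unitary.mul_star_self (dft N))]
  simp only [map_sum, map_smul]

omit [NeZero N] in
theorem gateMap_reflection_ket (v : Fin N → ℝ) (c : ℝ) (hc : c * ∑ y, v y ^ 2 = 2) :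
    gateMap f (regGate (queryReg L) (reflection v c hc)) (ket (conf L (enc z) p x b T)) =
      ∑ y, (((if y = z then 1 else 0) - c * v y * v z : ℝ) : ℂ) •
        ket (conf L (enc y) p x b T) := by
  rw [gateMap_regGate_ket]
  simp only [conf_queryReg, put_queryReg]
  rw [sum_bits]
  · refine Finset.sum_congr rfl fun y _ => ?_
    simp only [reflection, Matrix.of_apply, extendBits_enc, enc_injective.eq_iff]
  · intro u hu
    have hne : u ≠ enc z := by
      rintro rfl
      rw [ofBits_enc] at hu
      exact absurd z.2 hu.not_gt
    simp [reflection, extendBits_of_le v u hu, hne]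

/-- The query register holds an element `a` of `A`, and the contents of the phase register are
in the table. -/
def Hit (A : Finset (Fin N)) (q p : Fin (width N) → Bool)
    (T : Fin s → Fin (width N) → Bool) : Prop :=
  (∃ a ∈ A, q = enc a) ∧ ∃ k, T k = p

/-- The elements of `A` that collide with an element of the family `xs`. -/
noncomputable def marked (f : Fin N → Fin N) (xs : Fin s → Fin N) (A : Finset (Fin N)) :
    Finset (Fin N) :=
  haveI := Classical.decPred fun y => ∃ k, f (xs k) = f y
  A.filter fun y => ∃ k, f (xs k) = f y

omit [NeZero N] in
theorem mem_marked {xs : Fin s → Fin N} {A : Finset (Fin N)} :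
    y ∈ marked f xs A ↔ y ∈ A ∧ ∃ k, f (xs k) = f y := by
  simp [marked]

omit [NeZero N] in
theorem hit_iff {xs : Fin s → Fin N} {A : Finset (Fin N)} :
    Hit A (enc y) (enc (f y)) (fun k => enc (f (xs k))) ↔ y ∈ marked f xs A := by
  simp [Hit, mem_marked, enc_injective.eq_iff]

open Classical in
/-- The gate that changes the sign of the basis states with `Hit`. -/
noncomputable def flipGate (A : Finset (Fin N)) : Gate N S :=
  .unitary (monomialUnitary 1 (fun σ => if Hit A (fun i => σ (queryReg L i))
    (fun i => σ (phaseReg L i)) (fun k i => σ (slotReg L k i)) then -1 else 1) (fun σ => by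
      split_ifs <;> simp))

omit [NeZero N] in
open Classical in
theorem gateMap_flip_ket (A : Finset (Fin N)) (q : Fin (width N) → Bool) :
    gateMap f (flipGate L A) (ket (conf L q p x b T)) =
      (if Hit A q p T then (-1 : ℂ) else 1) • ket (conf L q p x b T) := by
  change (monomialUnitary _ _ _).1 *ᵥ _ = _
  rw [monomialUnitary_ket]
  simp only [conf_queryReg, conf_phaseReg, conf_slotReg, Equiv.Perm.coe_one, id_eq]

/-- One Grover iteration. -/
noncomputable def iteration (A : Finset (Fin N)) {D : Finset (Fin N)} (hD : D.Nonempty) :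
    Circuit N S :=
  compute L ++ flipGate L A :: uncompute L ++
    [regGate (queryReg L) (reflection (unif D) 2 (two_mul_sum_unif_sq hD))]

/-- A superposition of contents of the query register. -/
noncomputable def sup (g : Fin N → ℝ) : State S :=
  ∑ y, (g y : ℂ) • ket (conf L (enc y) (enc 0) (fun _ => false) false T)

/-- Computing and uncomputing `f y` around the sign flip leaves the phase register and the table
unchanged, so only the amplitudes of the query register evolve. -/
theorem runMap_iteration {D : Finset (Fin N)} (hD : D.Nonempty) (A : Finset (Fin N))
    (xs : Fin s → Fin N) (j : ℕ) :
    runMap f (iteration L A hD)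
        (sup L (fun k => enc (f (xs k))) (amp D (marked f xs A) j)) =
      sup L (fun k => enc (f (xs k))) (amp D (marked f xs A) (j + 1)) := by
  classical
  set M := marked f xs A
  have hrun : ∀ ψ : State S, runMap f (iteration L A hD) ψ =
      gateMap f (regGate (queryReg L) (reflection (unif D) 2 (two_mul_sum_unif_sq hD)))
        (runMap f (uncompute L) (gateMap f (flipGate L A) (runMap f (compute L) ψ))) := by
    intro ψ
    rw [iteration, List.append_assoc, runMap_append, List.cons_append]
    rw [runMap_cons, runMap_append, runMap_cons, runMap_nil]
  rw [hrun, sup, sup]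
  simp only [map_sum, map_smul, runMap_compute, gateMap_flip_ket, hit_iff, runMap_uncompute,
    gateMap_reflection_ket, Finset.smul_sum, smul_smul]
  rw [Finset.sum_comm]
  refine Finset.sum_congr rfl fun y _ => ?_
  rw [← Finset.sum_smul]
  congr 1
  have h1 : ∀ z : Fin N, (amp D M j z : ℂ) * ((if z ∈ M then (-1 : ℂ) else 1) *
      (((if y = z then 1 else 0) - 2 * unif D y * unif D z : ℝ) : ℂ)) =
      ((if y = z then flipSign M (amp D M j) z else 0) -
        2 * unif D y * (unif D z * flipSign M (amp D M j) z) : ℝ) := by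
    intro z
    unfold flipSign
    split_ifs <;> push_cast <;> ring
  have h2 : ∑ z : Fin N, (amp D M j z : ℂ) * ((if z ∈ M then (-1 : ℂ) else 1) *
      (((if y = z then 1 else 0) - 2 * unif D y * unif D z : ℝ) : ℂ)) =
      (amp D M (j + 1) y : ℂ) := by
    simp only [h1]
    rw [← Complex.ofReal_sum, Finset.sum_sub_distrib, ← Finset.mul_sum]
    simp [amp]
  rw [← h2]
  refine Finset.sum_congr rfl fun z _ => ?_
  ring

theorem gateMap_prep {D : Finset (Fin N)} (hD : D.Nonempty) (h0 : (0 : Fin N) ∉ D)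
    (M : Finset (Fin N)) :
    gateMap f (regGate (queryReg L) (reflection (prepVector D) 1
        (one_mul_sum_prepVector_sq hD h0))) (ket (base L T)) = sup L T (amp D M 0) := by
  have hb : base L T = conf L (enc 0) (enc 0) (fun _ => false) false T := by
    rw [base, enc_zero]
  rw [hb, gateMap_reflection_ket, sup]
  refine Finset.sum_congr rfl fun y _ => ?_
  congr 2
  simp [prepVector, amp, unif, h0]

/-- The contents of the result register that are computed from the other registers. -/
noncomputable def result (xs : Fin s → Fin N) (A : Finset (Fin N)) (q p : Fin (width N) → Bool)
    (T : Fin s → Fin (width N) → Bool) : (Fin (width N) → Bool) × Bool :=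
  haveI := Classical.propDecidable (Hit A q p T)
  if h : Hit A q p T then (enc (xs h.2.choose), true) else (fun _ => false, false)

/-- The gate that writes the result of a search. -/
noncomputable def resultGate (xs : Fin s → Fin N) (A : Finset (Fin N)) : Gate N S :=
  .unitary (monomialUnitary (xorWrite (resultReg L) (resultReg L).injective
    (fun σ =>
      let r := result xs A (fun i => σ (queryReg L i)) (fun i => σ (phaseReg L i))
        (fun k i => σ (slotReg L k i))
      Sum.elim r.1 fun _ => r.2)
    (fun u σ => by
      have h1 : ∀ i, put (resultReg L) u σ (queryReg L i) = σ (queryReg L i) := fun i =>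
        put_resultReg_other L u σ _ (by rintro (j | j) h <;> simp [resultIndex] at h)
      have h2 : ∀ i, put (resultReg L) u σ (phaseReg L i) = σ (phaseReg L i) := fun i =>
        put_resultReg_other L u σ _ (by rintro (j | j) h <;> simp [resultIndex] at h)
      have h3 : ∀ k i, put (resultReg L) u σ (slotReg L k i) = σ (slotReg L k i) := fun k i =>
        put_resultReg_other L u σ _ (by rintro (j | j) h <;> simp [resultIndex] at h)
      simp only [h1, h2, h3])) (fun _ => 1) (fun _ => by simp))

omit [NeZero N] in
theorem gateMap_result_ket (xs : Fin s → Fin N) (A : Finset (Fin N))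
    (q : Fin (width N) → Bool) :
    gateMap f (resultGate L xs A) (ket (conf L q p (fun _ => false) false T)) =
      ket (conf L q p (result xs A q p T).1 (result xs A q p T).2 T) := by
  change (monomialUnitary _ _ _).1 *ᵥ _ = _
  rw [monomialUnitary_ket, one_smul, xorWrite_apply]
  · simp only [conf_queryReg, conf_phaseReg, conf_slotReg, put_resultReg]
  · rintro (i | i) <;> exact conf_apply L q p _ _ T _

/-- One run of Grover's algorithm on `D` with `j` iterations, followed by the output of a
collision if one has been found. -/
noncomputable def attempt (xs : Fin s → Fin N) (A : Finset (Fin N)) {D : Finset (Fin N)}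
    (hD : D.Nonempty) (h0 : (0 : Fin N) ∉ D) (j : ℕ) : Circuit N S :=
  (regGate (queryReg L) (reflection (prepVector D) 1 (one_mul_sum_prepVector_sq hD h0)) ::
    ((List.replicate j (iteration L A hD)).flatten ++ (compute L ++ [resultGate L xs A]))) ++
  .output (flagQubit L) (matchReg L) (queryReg L) :: (workQubits L).map .reset

theorem queries_attempt (xs : Fin s → Fin N) (A : Finset (Fin N)) {D : Finset (Fin N)}
    (hD : D.Nonempty) (h0 : (0 : Fin N) ∉ D) (j : ℕ) :
    (attempt L xs A hD h0 j).queries = 2 * j + 1 := by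
  have h1 : List.countP Gate.isQuery (iteration L A hD) = 2 := by
    simp [iteration, compute, uncompute, flipGate, regGate, Gate.isQuery, List.countP_cons]
  have h2 : List.countP Gate.isQuery ((workQubits L).map (Gate.reset (N := N))) = 0 := by
    simp [List.countP_eq_zero, Gate.isQuery]
  have h3 : List.countP Gate.isQuery (List.replicate j (iteration L A hD)).flatten = 2 * j := by
    simp [List.countP_flatten, h1, mul_comm]
  have h4 : List.countP Gate.isQuery (compute L) = 1 := by
    simp [compute, regGate, Gate.isQuery, List.countP_cons]
  simp [Circuit.queries, attempt, h2, h3, h4, regGate, resultGate, Gate.isQuery]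

/-- The word that an attempt outputs when it measures `y`. -/
noncomputable def attemptWord (xs : Fin s → Fin N) (A : Finset (Fin N)) : Word :=
  wordOf ((result xs A (enc y) (enc (f y)) fun k => enc (f (xs k))).2,
    (result xs A (enc y) (enc (f y)) fun k => enc (f (xs k))).1, enc y)

-- The table holds values only; the matching point is recovered from the slot index, because `xs` is
-- hard-wired into the result gate.
omit [NeZero N] in
theorem attemptWord_of_mem {xs : Fin s → Fin N} {A : Finset (Fin N)} (hy : y ∈ marked f xs A) :
    ∃ k, f (xs k) = f y ∧ attemptWord f y xs A = some ((xs k).val, y.val) := by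
  have h := (hit_iff f y).2 hy
  refine ⟨h.2.choose, enc_injective h.2.choose_spec, ?_⟩
  simp [attemptWord, result, h, wordOf, ofBits_enc]

omit [NeZero N] in
theorem attemptWord_of_notMem {xs : Fin s → Fin N} {A : Finset (Fin N)}
    (hy : y ∉ marked f xs A) : attemptWord f y xs A = none := by
  have h := mt (hit_iff f y).1 hy
  simp [attemptWord, result, h, wordOf]

/-- The output gate copies the query register and thereby measures `y`; the resets then erase
everything that depends on `y`, so the table can be reused. -/
theorem prob_attempt (xs : Fin s → Fin N) (A : Finset (Fin N)) {D : Finset (Fin N)}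
    (hD : D.Nonempty) (h0 : (0 : Fin N) ∉ D) (j : ℕ) (C : Circuit N S) (E : Set (List Word)) :
    prob f (attempt L xs A hD h0 j ++ C) (ket (base L fun k => enc (f (xs k)))) E =
      ∑ y, amp D (marked f xs A) j y ^ 2 *
        prob f C (ket (base L fun k => enc (f (xs k)))) {w | attemptWord f y xs A :: w ∈ E} := by
  set T : Fin s → Fin (width N) → Bool := fun k => enc (f (xs k)) with hT
  have hcoh : ∀ g ∈ (regGate (queryReg L) (reflection (prepVector D) 1
      (one_mul_sum_prepVector_sq hD h0)) ::
      ((List.replicate j (iteration L A hD)).flatten ++ (compute L ++ [resultGate L xs A]))),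
      Gate.Coherent g := by
    have h1 : ∀ g ∈ compute L, Gate.Coherent g := by
      simp [compute, regGate, Gate.Coherent]
    have h2 : ∀ g ∈ uncompute L, Gate.Coherent g := by
      simp [uncompute, regGate, Gate.Coherent]
    have h3 : ∀ g ∈ iteration L A hD, Gate.Coherent g := by
      intro g hg
      simp only [iteration, List.mem_append, List.mem_cons, List.not_mem_nil,
        or_false] at hg
      rcases hg with (hg | rfl | hg) | rfl
      · exact h1 g hg
      · trivial
      · exact h2 g hg
      · trivial
    intro g hg
    simp only [List.mem_append, List.mem_cons, List.not_mem_nil, or_false, List.mem_flatten,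
      List.mem_replicate] at hg
    rcases hg with rfl | ⟨l, ⟨_, rfl⟩, hg⟩ | hg | rfl
    · trivial
    · exact h3 g hg
    · exact h1 g hg
    · trivial
  have hiter : ∀ i, runMap f (List.replicate i (iteration L A hD)).flatten
      (sup L T (amp D (marked f xs A) 0)) = sup L T (amp D (marked f xs A) i) := by
    intro i
    induction i with
    | zero => rfl
    | succ i ih =>
      rw [List.replicate_succ', List.flatten_append, runMap_append, ih]
      simpa using runMap_iteration L f hD A xs i
  rw [attempt, List.append_assoc, prob_coherent_append _ _ _ hcoh]
  have hrun : runMap f (regGate (queryReg L) (reflection (prepVector D) 1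
      (one_mul_sum_prepVector_sq hD h0)) ::
      ((List.replicate j (iteration L A hD)).flatten ++ (compute L ++ [resultGate L xs A])))
      (ket (base L T)) = ∑ y, (amp D (marked f xs A) j y : ℂ) •
        ket (conf L (enc y) (enc (f y)) (result xs A (enc y) (enc (f y)) T).1
          (result xs A (enc y) (enc (f y)) T).2 T) := by
    rw [runMap_cons, gateMap_prep L f T hD h0 (marked f xs A), runMap_append, runMap_append,
      hiter, runMap_cons, runMap_nil]
    simp only [sup, map_sum, map_smul, runMap_compute, gateMap_result_ket]
  rw [hrun, List.cons_append, prob_output_sum]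
  · refine Finset.sum_congr rfl fun y _ => ?_
    rw [Complex.normSq_ofReal, ← sq, prob_resets_ket, reset_workQubits]
    congr 3
    ext w
    have : outContent (flagQubit L) (matchReg L) (queryReg L)
        (conf L (enc y) (enc (f y)) (result xs A (enc y) (enc (f y)) T).1
          (result xs A (enc y) (enc (f y)) T).2 T) =
        ((result xs A (enc y) (enc (f y)) T).2, (result xs A (enc y) (enc (f y)) T).1,
          enc y) := by
      rw [outContent, conf_flagQubit, conf_matchReg, conf_queryReg]
    rw [this]
    rfl
  · intro y y' h
    have := congrArg (fun v => v.2.2) h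
    simp only [outContent, conf_queryReg] at this
    exact enc_injective this

end Attempt

/-! ### Loading the table -/

section Load

variable {N s S : ℕ} [NeZero N] (L : Reg (width N) s ↪ Fin S)

/-- The gate that writes `x` into the empty query register. -/
noncomputable def writeGate (x : Fin N) : Gate N S :=
  .unitary (monomialUnitary (xorWrite (queryReg L) (queryReg L).injective (fun _ => enc x)
    fun _ _ => rfl) (fun _ => 1) (fun _ => by simp))

/-- The gate that copies the phase register into an empty slot of the table. -/
noncomputable def storeGate (k : Fin s) : Gate N S :=
  .unitary (monomialUnitary (xorWrite (slotReg L k) (slotReg L k).injective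
    (fun σ i => σ (phaseReg L i)) (fun u σ => funext fun i => put_apply_of_notMem _ _ fun j hj => by
      simpa using L.injective hj)) (fun _ => 1) (fun _ => by simp))

/-- Writes `f x` into an entry of the table. -/
noncomputable def loadEntry (k : Fin s) (x : Fin N) : Circuit N S :=
  (writeGate L x :: (compute L ++ [storeGate L k])) ++ (workQubits L).map .reset

variable (f : Fin N → Fin N)

/-- The slot must be empty because storing is an exclusive or. -/
theorem prob_loadEntry (k : Fin s) (x : Fin N) (T : Fin s → Fin (width N) → Bool)
    (hT : T k = fun _ => false) (C : Circuit N S) (E : Set (List Word)) :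
    prob f (loadEntry L k x ++ C) (ket (base L T)) E =
      prob f C (ket (base L (Function.update T k (enc (f x))))) E := by
  have hcoh : ∀ g ∈ writeGate L x :: (compute L ++ [storeGate L k]), Gate.Coherent g := by
    simp [compute, regGate, Gate.Coherent, writeGate, storeGate]
  have h1 : gateMap f (writeGate L x) (ket (base L T)) =
      ket (conf L (enc x) (enc 0) (fun _ => false) false T) := by
    change Matrix.mulVec (monomialUnitary _ _ _).1 _ = _
    rw [monomialUnitary_ket, one_smul, xorWrite_apply, base, put_queryReg, enc_zero]
    exact fun a => conf_apply L _ _ _ _ _ _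
  have h2 : gateMap f (storeGate L k)
      (ket (conf L (enc x) (enc (f x)) (fun _ => false) false T)) =
      ket (conf L (enc x) (enc (f x)) (fun _ => false) false
        (Function.update T k (enc (f x)))) := by
    change Matrix.mulVec (monomialUnitary _ _ _).1 _ = _
    rw [monomialUnitary_ket, one_smul, xorWrite_apply, conf_phaseReg, put_slotReg]
    intro a
    exact (conf_apply L _ _ _ _ _ _).trans (congrFun hT a)
  rw [loadEntry, List.append_assoc, prob_coherent_append _ _ _ hcoh, runMap_cons, h1,
    runMap_append, runMap_compute, runMap_cons, runMap_nil, h2, prob_resets_ket,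
    reset_workQubits]

/-- Clears the memory and fills the table with the values of `f` on the family `xs`. -/
noncomputable def load (xs : Fin s → Fin N) : Circuit N S :=
  (List.finRange S).map .reset ++ (List.finRange s).flatMap fun k => loadEntry L k (xs k)

theorem prob_loadEntries (xs : Fin s → Fin N) (C : Circuit N S) (E : Set (List Word))
    (l : List (Fin s)) : l.Nodup → ∀ T : Fin s → Fin (width N) → Bool,
    (∀ k ∈ l, T k = fun _ => false) →
    prob f ((l.flatMap fun k => loadEntry L k (xs k)) ++ C) (ket (base L T)) E =
      prob f C (ket (base L fun k => if k ∈ l then enc (f (xs k)) else T k)) E := by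
  induction l with
  | nil => intro _ T _; simp
  | cons k l ih =>
    intro hl T hT
    rw [List.nodup_cons] at hl
    rw [List.flatMap_cons, List.append_assoc, prob_loadEntry L f k (xs k) T (hT k (by simp)),
      ih hl.2]
    · congr 3
      funext k'
      by_cases h : k' = k
      · subst h; simp [hl.1]
      · simp [h]
    · intro k' hk'
      have : k' ≠ k := by rintro rfl; exact hl.1 hk'
      simpa [this] using hT k' (by simp [hk'])

theorem prob_load (xs : Fin s → Fin N) (C : Circuit N S) (E : Set (List Word))
    (σ : Fin S → Bool) :
    prob f (load L xs ++ C) (ket σ) E =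
      prob f C (ket (base L fun k => enc (f (xs k)))) E := by
  rw [load, List.append_assoc, prob_resets_ket]
  have : (fun i => if i ∈ List.finRange S then false else σ i) =
      base L (fun _ _ => false) := by
    funext i
    by_cases h : ∃ a, L a = i
    · obtain ⟨a, rfl⟩ := h
      rw [base, conf_apply]
      rcases a with ((i | i) | (i | i | i)) <;> simp [content]
    · push Not at h
      rw [base, conf, put_apply_of_notMem _ _ h]
      simp
  rw [this, prob_loadEntries _ _ _ _ _ _ (List.nodup_finRange s) _ (fun _ _ => rfl)]
  simp

theorem queries_load (xs : Fin s → Fin N) : (load L xs).queries = s := by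
  have h1 : ∀ l : List (Fin S), List.countP Gate.isQuery (l.map (Gate.reset (N := N))) = 0 := by
    simp [List.countP_eq_zero, Gate.isQuery]
  have h2 : ∀ k, List.countP Gate.isQuery (loadEntry L k (xs k)) = 1 := by
    intro k
    simp [loadEntry, h1, List.countP_cons, compute, writeGate, storeGate, regGate, Gate.isQuery]
  simp [Circuit.queries, load, h1, List.countP_flatMap, h2, Function.comp_def]

end Load

/-! ### Success probabilities of composed circuits -/

section Compose

variable {N S : ℕ} (f : Fin N → Fin N)

/-- `C` returns to the basis state `σ`, outputs only pairs with `Ok`, and fails to output a pair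
with probability at most `ε`. -/
def Trial (C : Circuit N S) (σ : Fin S → Bool) (Ok : ℕ × ℕ → Prop) (ε : ℝ) : Prop :=
  ∀ (C' : Circuit N S) (E : Set (List Word)) (u v : ℝ), v ≤ u →
    (∀ w : List Word, (∀ p, some p ∈ w → Ok p) → v ≤ prob f C' (ket σ) {z | w ++ z ∈ E}) →
    (∀ w : List Word, (∀ p, some p ∈ w → Ok p) → (∃ p, some p ∈ w) →
      u ≤ prob f C' (ket σ) {z | w ++ z ∈ E}) →
    u - ε * (u - v) ≤ prob f (C ++ C') (ket σ) E

variable {f}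

theorem Trial.nil (σ : Fin S → Bool) (Ok : ℕ × ℕ → Prop) :
    Trial f ([] : Circuit N S) σ Ok 1 := by
  intro C' E u v _ h _
  have := h [] (by simp)
  simp only [List.nil_append] at this ⊢
  exact le_trans (by linarith) this

/-- If `C₁` fails, `C₂` still guarantees `u - ε₂ (u - v)`, which serves as the low value for `C₁`.
If `C₁` succeeds, `C₂` only adds admissible words, so the value `u` is kept. -/
theorem Trial.append {C₁ C₂ : Circuit N S} {σ : Fin S → Bool} {Ok : ℕ × ℕ → Prop} {ε₁ ε₂ : ℝ}
    (h₁ : Trial f C₁ σ Ok ε₁) (h₂ : Trial f C₂ σ Ok ε₂) (hε : 0 ≤ ε₂) :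
    Trial f (C₁ ++ C₂) σ Ok (ε₁ * ε₂) := by
  intro C' E u v huv hv hu
  have hmem : ∀ w₁ w₂ : List Word, (∀ p, some p ∈ w₁ → Ok p) → (∀ p, some p ∈ w₂ → Ok p) →
      ∀ p, some p ∈ w₁ ++ w₂ → Ok p := by
    intro w₁ w₂ h h' p hp
    rcases List.mem_append.1 hp with hp | hp
    exacts [h p hp, h' p hp]
  rw [List.append_assoc]
  have := h₁ (C₂ ++ C') E u (u - ε₂ * (u - v)) (by nlinarith) ?_ ?_
  · exact le_trans (by linarith) this
  · intro w₁ hw₁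
    refine h₂ C' _ u v huv (fun w₂ hw₂ => ?_) fun w₂ hw₂ hs => ?_
    · simpa using hv (w₁ ++ w₂) (hmem _ _ hw₁ hw₂)
    · obtain ⟨p, hp⟩ := hs
      simpa using hu (w₁ ++ w₂) (hmem _ _ hw₁ hw₂) ⟨p, by simp [hp]⟩
  · intro w₁ hw₁ hs
    obtain ⟨p, hp⟩ := hs
    have h : ∀ w₂ : List Word, (∀ p, some p ∈ w₂ → Ok p) →
        u ≤ prob f C' (ket σ) {z | w₂ ++ z ∈ {z | w₁ ++ z ∈ E}} := fun w₂ hw₂ => by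
      simpa using hu (w₁ ++ w₂) (hmem _ _ hw₁ hw₂) ⟨p, by simp [hp]⟩
    have := h₂ C' {z | w₁ ++ z ∈ E} u u le_rfl h fun w₂ hw₂ _ => h w₂ hw₂
    simpa using this

theorem Trial.flatMap {α : Type*} {C : α → Circuit N S} {σ : Fin S → Bool} {Ok : ℕ × ℕ → Prop}
    {ε : α → ℝ} (h : ∀ a, Trial f (C a) σ Ok (ε a)) (hε : ∀ a, 0 ≤ ε a) (l : List α) :
    Trial f (l.flatMap C) σ Ok (l.map ε).prod := by
  induction l with
  | nil => exact Trial.nil σ Ok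
  | cons a l ih =>
    rw [List.flatMap_cons, List.map_cons, List.prod_cons]
    refine (h a).append ih (List.prod_nonneg ?_)
    simp only [List.mem_map]
    rintro _ ⟨b, _, rfl⟩
    exact hε b

theorem trial_attempt {s : ℕ} [NeZero N] (L : Reg (width N) s ↪ Fin S) (xs : Fin s → Fin N)
    (A : Finset (Fin N)) {D : Finset (Fin N)} (hD : D.Nonempty) (h0 : (0 : Fin N) ∉ D) (j : ℕ)
    (Ok : ℕ × ℕ → Prop) (hOk : ∀ k, ∀ y ∈ A, f (xs k) = f y → Ok ((xs k).val, y.val)) :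
    Trial f (attempt L xs A hD h0 j) (base L fun k => enc (f (xs k))) Ok
      (1 - ∑ y ∈ marked f xs A, amp D (marked f xs A) j y ^ 2) := by
  classical
  intro C' E u v huv hv hu
  rw [prob_attempt]
  set M := marked f xs A
  have hsum := sum_amp_sq hD M j
  have hterm : ∀ y : Fin N, amp D M j y ^ 2 * v + (if y ∈ M then amp D M j y ^ 2 else 0) * (u - v) ≤
      amp D M j y ^ 2 * prob f C' (ket (base L fun k => enc (f (xs k))))
        {w | attemptWord f y xs A :: w ∈ E} := by
    intro y
    by_cases hy : y ∈ M
    · obtain ⟨k, hk, hw⟩ := attemptWord_of_mem f y hy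
      have := hu [attemptWord f y xs A] (by
        rw [hw]
        intro p hp
        simp only [List.mem_singleton, Option.some.injEq] at hp
        subst hp
        exact hOk k y ((mem_marked f y).1 hy).1 hk) (by rw [hw]; exact ⟨((xs k).val, y.val), by simp⟩)
      have h2 := mul_le_mul_of_nonneg_left this (sq_nonneg (amp D M j y))
      simp only [hy, if_true]
      refine le_trans (by linarith) h2
    · have hw := attemptWord_of_notMem f y hy
      have := hv [attemptWord f y xs A] (by rw [hw]; simp)
      have h2 := mul_le_mul_of_nonneg_left this (sq_nonneg (amp D M j y))
      simp only [hy, if_false]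
      refine le_trans (by linarith) h2
  refine le_trans (le_of_eq ?_) (Finset.sum_le_sum fun y _ => hterm y)
  rw [Finset.sum_add_distrib, ← Finset.sum_mul, ← Finset.sum_mul, hsum, Finset.sum_ite_mem,
    Finset.univ_inter]
  ring

/-- Only pairs with `Ok` are output, and at most `k` of the cells in `P` contain none of them. -/
def Valid {ι : Type*} (Ok : ℕ × ℕ → Prop) (cell : ℕ × ℕ → ι) (P : Finset ι) (k : ℕ)
    (w : List Word) : Prop :=
  (∀ p, some p ∈ w → Ok p) ∧
    {c : ι | c ∈ P ∧ ∀ p, some p ∈ w → cell p ≠ c}.ncard ≤ k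

variable (f) in
/-- `C` goes from the basis state `σ` to `σ'`, and the expected number of cells in `P` that
contain none of the pairs output is at most `ε`. -/
def Segment {ι : Type*} (Ok : ℕ × ℕ → Prop) (cell : ℕ × ℕ → ι) (C : Circuit N S)
    (σ σ' : Fin S → Bool) (P : Finset ι) (ε : ℝ) : Prop :=
  ∀ (C' : Circuit N S) (E : Set (List Word)) (a b : ℝ), 0 ≤ b →
    (∀ (k : ℕ) (w : List Word), Valid Ok cell P k w →
      a - b * k ≤ prob f C' (ket σ') {z | w ++ z ∈ E}) →
    a - b * ε ≤ prob f (C ++ C') (ket σ) E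

variable {ι : Type*} {Ok : ℕ × ℕ → Prop} {cell : ℕ × ℕ → ι}

theorem Segment.nil (σ : Fin S → Bool) : Segment f Ok cell ([] : Circuit N S) σ σ ∅ 0 := by
  intro C' E a b _ h
  simpa using h 0 [] (by simp [Valid])

theorem Valid.append [DecidableEq ι] {P₁ P₂ : Finset ι} {k₁ k₂ : ℕ} {w₁ w₂ : List Word}
    (h₁ : Valid Ok cell P₁ k₁ w₁) (h₂ : Valid Ok cell P₂ k₂ w₂) :
    Valid Ok cell (P₁ ∪ P₂) (k₁ + k₂) (w₁ ++ w₂) := by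
  refine ⟨?_, ?_⟩
  · intro p hp
    rcases List.mem_append.1 hp with hp | hp
    exacts [h₁.1 p hp, h₂.1 p hp]
  · have hfin : ∀ (P : Finset ι) (w : List Word),
        {c : ι | c ∈ P ∧ ∀ p, some p ∈ w → cell p ≠ c}.Finite := fun P w =>
      P.finite_toSet.subset fun c hc => hc.1
    refine le_trans (Set.ncard_le_ncard ?_ ((hfin P₁ w₁).union (hfin P₂ w₂)))
      ((Set.ncard_union_le _ _).trans (add_le_add h₁.2 h₂.2))
    rintro c ⟨hc, hw⟩
    rcases Finset.mem_union.1 hc with hc | hc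
    · exact Or.inl ⟨hc, fun p hp => hw p (by simp [hp])⟩
    · exact Or.inr ⟨hc, fun p hp => hw p (by simp [hp])⟩

/-- Linearity of expectation: the loss of `C₂` is absorbed into `a`, uniformly in the output of
`C₁`, while the slope `b` is passed on unchanged. -/
theorem Segment.append [DecidableEq ι] {C₁ C₂ : Circuit N S} {σ₁ σ₂ σ₃ : Fin S → Bool}
    {P₁ P₂ : Finset ι} {ε₁ ε₂ : ℝ} (h₁ : Segment f Ok cell C₁ σ₁ σ₂ P₁ ε₁)
    (h₂ : Segment f Ok cell C₂ σ₂ σ₃ P₂ ε₂) :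
    Segment f Ok cell (C₁ ++ C₂) σ₁ σ₃ (P₁ ∪ P₂) (ε₁ + ε₂) := by
  intro C' E a b hb h
  rw [List.append_assoc]
  have := h₁ (C₂ ++ C') E (a - b * ε₂) b hb ?_
  · exact le_trans (by linarith) this
  · intro k₁ w₁ hw₁
    have := h₂ C' {z | w₁ ++ z ∈ E} (a - b * k₁) b hb ?_
    · exact le_trans (by linarith) this
    · intro k₂ w₂ hw₂
      have := h (k₁ + k₂) (w₁ ++ w₂) (hw₁.append hw₂)
      push_cast at this
      simp only [List.append_assoc] at this
      exact le_trans (by linarith) this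

theorem Segment.flatMap [DecidableEq ι] {α : Type*} [DecidableEq α] (I : (Fin S → Bool) → Prop)
    {C : α → Circuit N S} {P : α → Finset ι} {ε : α → ℝ}
    (h : ∀ a σ, I σ → ∃ σ', I σ' ∧ Segment f Ok cell (C a) σ σ' (P a) (ε a)) (l : List α) :
    ∀ σ, I σ → ∃ σ', I σ' ∧
      Segment f Ok cell (l.flatMap C) σ σ' (l.toFinset.biUnion P) (l.map ε).sum := by
  induction l with
  | nil => exact fun σ hσ => ⟨σ, hσ, Segment.nil σ⟩
  | cons a l ih =>
    intro σ hσ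
    obtain ⟨σ₁, hσ₁, h₁⟩ := h a σ hσ
    obtain ⟨σ₂, hσ₂, h₂⟩ := ih σ₁ hσ₁
    refine ⟨σ₂, hσ₂, ?_⟩
    rw [List.flatMap_cons, List.map_cons, List.sum_cons, List.toFinset_cons,
      Finset.biUnion_insert]
    exact h₁.append h₂

/-- With a single cell the number of missed cells is 0 or 1, so the two levels are `u = a` and `v =
a - b`. -/
theorem Trial.segment {C : Circuit N S} {σ : Fin S → Bool} {Ok' : ℕ × ℕ → Prop} {ε : ℝ}
    (h : Trial f C σ Ok' ε) (c : ι) (hOk : ∀ p, Ok' p → Ok p ∧ cell p = c) :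
    Segment f Ok cell C σ σ {c} ε := by
  intro C' E a b hb hw
  have := h C' E a (a - b) (by linarith) ?_ ?_
  · exact le_trans (by linarith) this
  · intro w hw'
    have := hw 1 w ⟨fun p hp => (hOk p (hw' p hp)).1, ?_⟩
    · simpa using this
    · refine (Set.ncard_le_ncard (t := {c}) ?_).trans (by simp)
      rintro x ⟨hx, _⟩
      simpa using hx
  · rintro w hw' ⟨p, hp⟩
    have := hw 0 w ⟨fun p hp => (hOk p (hw' p hp)).1, ?_⟩
    · simpa using this
    · rw [Nat.le_zero, Set.ncard_eq_zero ((Set.finite_singleton c).subset fun x hx => by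
        simpa using hx.1)]
      ext x
      simp only [Finset.mem_singleton, Set.mem_ofPred_eq, Set.mem_empty_iff_false, iff_false]
      rintro ⟨rfl, h2⟩
      exact h2 p hp (hOk p (hw' p hp)).2

theorem segment_load {s : ℕ} [NeZero N] (L : Reg (width N) s ↪ Fin S) (xs : Fin s → Fin N)
    (σ : Fin S → Bool) :
    Segment f Ok cell (load L xs) σ (base L fun k => enc (f (xs k))) ∅ 0 := by
  intro C' E a b _ h
  rw [prob_load]
  simpa using h 0 [] (by simp [Valid])

/-- A circuit that outputs few pairs outside of the cells in `P` finds many collisions. -/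
theorem Segment.le_prob_solves {C : Circuit N S} {σ σ' : Fin S → Bool} {P : Finset ι} {ε : ℝ}
    (h : Segment f Ok cell C σ σ' P ε)
    (hOk : ∀ p, Ok p → ∃ a b : Fin N, p = (a.val, b.val) ∧ a < b ∧ f a = f b) {K : ℕ}
    (hK : K ≤ P.card) :
    1 - ε / ((P.card : ℝ) - K + 1) ≤ prob f C (ket σ) (Solves f K) := by
  classical
  have hpos : (0 : ℝ) < (P.card : ℝ) - K + 1 := by
    have : (K : ℝ) ≤ P.card := Nat.cast_le.2 hK
    linarith
  -- Markov's inequality: with this slope the affine bound is at most 1 always, and at most 0 once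
  -- `k ≥ |P| - K + 1`, the first number of missed cells that may leave fewer than `K` hits.
  have := h [] (Solves f K) 1 (1 / ((P.card : ℝ) - K + 1)) (by positivity) ?_
  · rw [List.append_nil] at this
    refine le_trans (le_of_eq ?_) this
    ring
  intro k w hw
  by_cases hk : K + k ≤ P.card
  · have hsol : w ∈ Solves f K := by
      refine ⟨fun x y hxy => ?_, ?_⟩
      · obtain ⟨a, b, hab, hlt, hf⟩ := hOk _ (hw.1 _ hxy)
        simp only [Prod.mk.injEq] at hab
        exact ⟨a, b, hab.1.symm, hab.2.symm, hlt.ne, hf⟩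
      · set F := P.filter fun c => ∃ p, some p ∈ w ∧ cell p = c with hF
        have hcard : K ≤ F.card := by
          have h1 : (P.filter fun c => ¬ ∃ p, some p ∈ w ∧ cell p = c).card ≤ k := by
            rw [← Set.ncard_coe_finset]
            refine le_trans (le_of_eq ?_) hw.2
            congr 1
            ext c
            simp
          have h2 := Finset.card_filter_add_card_filter_not (s := P)
            (fun c => ∃ p, some p ∈ w ∧ cell p = c)
          rw [← hF] at h2
          omega
        have hex : ∀ c ∈ F, ∃ ab : Fin N × Fin N, some (ab.1.val, ab.2.val) ∈ w ∧
            cell (ab.1.val, ab.2.val) = c ∧ ab.1 < ab.2 ∧ f ab.1 = f ab.2 := by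
          intro c hc
          obtain ⟨p, hp, hpc⟩ := (Finset.mem_filter.1 hc).2
          obtain ⟨a, b, rfl, hlt, hf⟩ := hOk _ (hw.1 _ hp)
          exact ⟨(a, b), hp, hpc, hlt, hf⟩
        rcases F.eq_empty_or_nonempty with hF0 | ⟨c₀, hc₀⟩
        · rw [hF0, Finset.card_empty] at hcard
          exact hcard.trans (Nat.zero_le _)
        have : Nonempty (Fin N × Fin N) := ⟨(hex c₀ hc₀).choose⟩
        choose! g hg using hex
        refine hcard.trans ?_
        rw [← Set.ncard_coe_finset]
        refine Set.ncard_le_ncard_of_injOn (fun c => s((g c).1, (g c).2)) ?_ ?_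
          (Set.toFinite _)
        · intro c hc
          obtain ⟨h1, h2, h3, h4⟩ := hg c hc
          exact ⟨(g c).1, (g c).2, rfl, ⟨h3.ne, h4⟩, h1⟩
        · intro c hc c' hc' he
          obtain ⟨-, h2, h3, -⟩ := hg c hc
          obtain ⟨-, h2', h3', -⟩ := hg c' hc'
          -- Equal ordered pairs have equal cells; swapped ones are excluded by the order `a < b`
          -- built into `Ok`.
          simp only [Sym2.eq_iff] at he
          rcases he with ⟨e1, e2⟩ | ⟨e1, e2⟩
          · rw [← h2, ← h2', e1, e2]
          · rw [e1, e2] at h3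
            exact absurd h3 h3'.not_gt
    have h1 : prob f ([] : Circuit N S) (ket σ') {z | w ++ z ∈ Solves f K} = 1 := by
      simp [prob, hsol, normSq_ket]
    rw [h1]
    have : 0 ≤ 1 / ((P.card : ℝ) - K + 1) * k := by positivity
    linarith
  · refine le_trans ?_ (prob_nonneg _ _ _ _)
    have : ((P.card : ℝ) - K + 1) ≤ k := by
      have : P.card + 1 ≤ K + k := by omega
      have : ((P.card : ℝ) + 1) ≤ K + k := by exact_mod_cast this
      linarith
    have h2 : 1 ≤ (k : ℝ) / ((P.card : ℝ) - K + 1) := (one_le_div hpos).2 this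
    rw [one_div_mul_eq_div]
    linarith

end Compose

/-! ### Success probability of Grover's algorithm -/

/-- Rotation by `2θ` in the plane of the uniform superpositions over `M` and `D \ M`. The sign `(-1)
^ j` arises because the iteration uses `1 - 2uuᵀ` in place of `2uuᵀ - 1`. -/
theorem amp_eq {N : ℕ} {D M : Finset (Fin N)} (hD : D.Nonempty) (hM : M ⊆ D) {θ : ℝ}
    (hs : 0 < Real.sin θ) (hc : 0 < Real.cos θ)
    (hθ : Real.sin θ ^ 2 * D.card = M.card) (j : ℕ) (y : Fin N) :
    amp D M j y = (-1) ^ j * (if y ∈ M then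
      Real.sin ((2 * j + 1) * θ) / (Real.sqrt D.card * Real.sin θ) else if y ∈ D then
      Real.cos ((2 * j + 1) * θ) / (Real.sqrt D.card * Real.cos θ) else 0) := by
  have hn : (0 : ℝ) < D.card := Nat.cast_pos.2 hD.card_pos
  have hq : 0 < Real.sqrt D.card := Real.sqrt_pos.2 hn
  have hqq : Real.sqrt D.card ^ 2 = D.card := Real.sq_sqrt hn.le
  set q := Real.sqrt D.card with hqdef
  induction j generalizing y with
  | zero =>
    by_cases h1 : y ∈ M
    · simp only [amp, unif, ← hqdef, hM h1, h1, if_true]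
      field_simp
      simp
    · by_cases h2 : y ∈ D
      · simp only [amp, unif, ← hqdef, h2, h1, if_true, if_false]
        field_simp
        simp
      · simp [amp, unif, h1, h2]
  | succ j ih =>
    set φ := (2 * (j : ℝ) + 1) * θ with hφ
    have hφ' : (2 * ((j + 1 : ℕ) : ℝ) + 1) * θ = φ + 2 * θ := by
      rw [hφ]
      push_cast
      ring
    have hcard : ((D \ M).card : ℝ) = Real.cos θ ^ 2 * D.card := by
      rw [Finset.cast_card_sdiff hM, ← hθ, Real.cos_sq']
      ring
    have hI : ∑ z, unif D z * flipSign M (amp D M j) z = (-1) ^ j * Real.cos (φ + θ) := by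
      have hterm : ∀ z, unif D z * flipSign M (amp D M j) z =
          (if z ∈ M then -((-1) ^ j * (Real.sin φ / (q ^ 2 * Real.sin θ))) else 0) +
          (if z ∈ D \ M then (-1) ^ j * (Real.cos φ / (q ^ 2 * Real.cos θ)) else 0) := by
        intro z
        by_cases h1 : z ∈ M
        · have h2 := hM h1
          simp only [unif, flipSign, ih, ← hqdef, h1, h2, if_true, Finset.mem_sdiff, not_true,
            and_false, if_false]
          field_simp
          ring
        · by_cases h2 : z ∈ D
          · simp only [unif, flipSign, ih, ← hqdef, h1, h2, if_true, Finset.mem_sdiff,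
              not_false_eq_true, and_true, if_false]
            field_simp
            ring
          · simp [unif, flipSign, h1, h2]
      simp only [hterm, Finset.sum_add_distrib, Finset.sum_ite_mem, Finset.univ_inter,
        Finset.sum_const, nsmul_eq_mul]
      rw [hcard, ← hθ, ← hqq, Real.cos_add]
      field_simp
      ring
    simp only [amp, hI]
    rw [hφ']
    have e1 : Real.sin (φ + 2 * θ) = Real.sin φ + 2 * Real.sin θ * Real.cos (φ + θ) := by
      rw [Real.sin_add, Real.cos_add, Real.sin_two_mul, Real.cos_two_mul, Real.cos_sq']
      ring
    have e2 : Real.cos (φ + 2 * θ) = 2 * Real.cos θ * Real.cos (φ + θ) - Real.cos φ := by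
      rw [Real.cos_add, Real.cos_add, Real.sin_two_mul, Real.cos_two_mul]
      ring
    by_cases h1 : y ∈ M
    · have h2 := hM h1
      simp only [unif, flipSign, ih, ← hqdef, h1, h2, if_true, e1, pow_succ]
      field_simp
      ring
    · by_cases h2 : y ∈ D
      · simp only [unif, flipSign, ih, ← hqdef, h1, h2, if_true, if_false, e2, pow_succ]
        field_simp
        ring
      · simp [unif, flipSign, ih, h1, h2]

/-- Telescoping: each summand contributes `sin (4(j+1)θ) - sin (4jθ)`. -/
theorem two_mul_sin_mul_sum_cos (θ : ℝ) (m : ℕ) :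
    2 * Real.sin (2 * θ) * ∑ j ∈ Finset.range m, Real.cos ((4 * j + 2) * θ) =
      Real.sin (4 * m * θ) := by
  induction m with
  | zero => simp
  | succ m ih =>
    rw [Finset.sum_range_succ, mul_add, ih]
    have h1 : 4 * ((m + 1 : ℕ) : ℝ) * θ = (4 * m + 2) * θ + 2 * θ := by push_cast; ring
    have h2 : 4 * (m : ℝ) * θ = (4 * m + 2) * θ - 2 * θ := by ring
    rw [h1, h2, Real.sin_add, Real.sin_sub]
    ring

/-- The sum equals `m/2 - sin (4mθ) / (4 sin 2θ)`, and `hm` bounds the subtracted term by `m/4`. -/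
theorem le_sum_sin_sq {θ : ℝ} {m : ℕ} (hθ : 0 < Real.sin (2 * θ)) (hm : 1 ≤ m * Real.sin (2 * θ)) :
    (m : ℝ) / 4 ≤ ∑ j ∈ Finset.range m, Real.sin ((2 * j + 1) * θ) ^ 2 := by
  have h1 : ∀ j : ℕ, Real.sin ((2 * j + 1) * θ) ^ 2 =
      1 / 2 - Real.cos ((4 * j + 2) * θ) / 2 := by
    intro j
    have : (4 * (j : ℝ) + 2) * θ = 2 * ((2 * j + 1) * θ) := by ring
    rw [this, Real.cos_two_mul, Real.cos_sq']
    ring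
  simp only [h1, Finset.sum_sub_distrib, Finset.sum_const, Finset.card_range, nsmul_eq_mul,
    ← Finset.sum_div]
  have h2 := two_mul_sin_mul_sum_cos θ m
  have h3 := Real.sin_le_one (4 * m * θ)
  set c := ∑ j ∈ Finset.range m, Real.cos ((4 * j + 2) * θ)
  have h4 : c ≤ m / 2 := by
    by_contra hcon
    push Not at hcon
    nlinarith [mul_lt_mul_of_pos_left hcon hθ]
  linarith

/-- Grover's algorithm with a random number of iterations succeeds with probability `1 / 4`. -/
theorem le_sum_success {N : ℕ} {D M : Finset (Fin N)} (hM : M ⊆ D) (hM0 : M.Nonempty)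
    (hcard : 2 * M.card ≤ D.card) {m : ℕ} (hm : D.card ≤ m ^ 2) :
    (m : ℝ) / 4 ≤ ∑ j ∈ Finset.range m, ∑ y ∈ M, amp D M j y ^ 2 := by
  have hD : D.Nonempty := hM0.mono hM
  have hn : (0 : ℝ) < D.card := Nat.cast_pos.2 hD.card_pos
  have ht : (1 : ℝ) ≤ M.card := by exact_mod_cast hM0.card_pos
  have hc2 : 2 * (M.card : ℝ) ≤ D.card := by exact_mod_cast hcard
  have hm' : (D.card : ℝ) ≤ (m : ℝ) ^ 2 := by exact_mod_cast hm
  set r : ℝ := M.card / D.card with hr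
  have hr0 : 0 < r := by positivity
  have hr1 : r ≤ 1 / 2 := by
    rw [hr, div_le_iff₀ hn]
    linarith
  have hsr0 : 0 < Real.sqrt r := Real.sqrt_pos.2 hr0
  have hsr1 : Real.sqrt r ≤ 1 := Real.sqrt_le_one.2 (by linarith)
  set θ := Real.arcsin (Real.sqrt r) with hθ
  have hsin : Real.sin θ = Real.sqrt r := Real.sin_arcsin (by linarith) hsr1
  have hcos : Real.cos θ = Real.sqrt (1 - r) := by
    rw [hθ, Real.cos_arcsin, Real.sq_sqrt hr0.le]
  have hs : 0 < Real.sin θ := by rwa [hsin]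
  have hc : 0 < Real.cos θ := by
    rw [hcos]
    exact Real.sqrt_pos.2 (by linarith)
  have hθ2 : Real.sin θ ^ 2 * D.card = M.card := by
    rw [hsin, Real.sq_sqrt hr0.le, hr]
    field_simp
  have hsucc : ∀ j : ℕ, ∑ y ∈ M, amp D M j y ^ 2 = Real.sin ((2 * j + 1) * θ) ^ 2 := by
    intro j
    have : ∀ y ∈ M, amp D M j y ^ 2 =
        Real.sin ((2 * j + 1) * θ) ^ 2 / (D.card * Real.sin θ ^ 2) := by
      intro y hy
      rw [amp_eq hD hM hs hc hθ2, if_pos hy, mul_pow, ← pow_mul, mul_comm j 2, pow_mul, div_pow,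
        mul_pow, Real.sq_sqrt hn.le]
      norm_num
    rw [Finset.sum_congr rfl this, Finset.sum_const, nsmul_eq_mul, ← hθ2]
    field_simp
  simp only [hsucc]
  have h2 : Real.sin (2 * θ) = 2 * Real.sin θ * Real.cos θ := Real.sin_two_mul θ
  have hpos : 0 < Real.sin (2 * θ) := by
    rw [h2]
    positivity
  refine le_sum_sin_sq hpos ?_
  -- Here `sin² 2θ = 4r(1 - r) ≥ 2r` because `r ≤ 1/2`, and `m² r ≥ |D| r = |M| ≥ 1`.
  have hsq : 1 ≤ (m * Real.sin (2 * θ)) ^ 2 := by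
    rw [h2, mul_pow, mul_pow, mul_pow, hsin, hcos, Real.sq_sqrt hr0.le,
      Real.sq_sqrt (by linarith : (0 : ℝ) ≤ 1 - r)]
    have h3 : 1 ≤ (D.card : ℝ) * r := by
      rw [hr, mul_div_cancel₀ _ hn.ne']
      exact ht
    have h4 : 1 ≤ (m : ℝ) ^ 2 * r := h3.trans (mul_le_mul_of_nonneg_right hm' hr0.le)
    nlinarith
  exact (one_le_sq_iff₀ (by positivity)).1 hsq

/-! ### Collisions of a uniformly random function -/

section Random

variable {N : ℕ}

/-- Exchanging `f y` with `c` is an involution of the pairs `(f, c)`: resampling one value preserves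
the uniform distribution. -/
theorem sum_resample (y : Fin N) (H : (Fin N → Fin N) → ℝ) :
    N * ∑ f, H f = ∑ f, ∑ c, H (Function.update f y c) := by
  let e : Equiv.Perm ((Fin N → Fin N) × Fin N) :=
    Function.Involutive.toPerm (fun p => (Function.update p.1 y p.2, p.1 y)) (by
      rintro ⟨f, c⟩
      simp)
  have h := Equiv.sum_comp e fun p => H p.1
  rw [Fintype.sum_prod_type, Fintype.sum_prod_type] at h
  have h2 : ∑ f : Fin N → Fin N, ∑ _c : Fin N, H f = N * ∑ f, H f := by
    simp [Finset.mul_sum]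
  rw [← h2, ← h]
  rfl

theorem sum_collision (x y : Fin N) (hxy : x ≠ y) (h : (Fin N → Fin N) → ℝ)
    (hh : ∀ f c, h (Function.update f y c) = h f) :
    N * ∑ f : Fin N → Fin N, (if f x = f y then h f else 0) = ∑ f, h f := by
  rw [sum_resample y]
  refine Finset.sum_congr rfl fun f _ => ?_
  simp [hh, Function.update_of_ne hxy]

theorem sum_collision_one (x y : Fin N) (hxy : x ≠ y) :
    N * ∑ f : Fin N → Fin N, (if f x = f y then (1 : ℝ) else 0) = (N : ℝ) ^ N := by
  rw [sum_collision x y hxy (fun _ => 1) fun _ _ => rfl]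
  simp

/-- Pairwise independence of collision events: some point of the first pair is absent from the
second, and its value is resampled. This point is `y` if `y ≠ y'`, and `x` otherwise. -/
theorem sum_collision_two (x y x' y' : Fin N) (hxy : x ≠ y) (hxy' : x' ≠ y') (h1 : x' ≠ y)
    (h2 : x ≠ y') (hne : x ≠ x' ∨ y ≠ y') :
    N * (N * ∑ f : Fin N → Fin N, (if f x = f y then if f x' = f y' then (1 : ℝ) else 0 else 0)) =
      (N : ℝ) ^ N := by
  by_cases hy : y = y'
  · have hx : x' ≠ x := fun e => hne.elim (fun h => h e.symm) fun h => h hy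
    have : ∀ f : Fin N → Fin N, (if f x = f y then if f x' = f y' then (1 : ℝ) else 0 else 0) =
        if f y = f x then if f x' = f y' then (1 : ℝ) else 0 else 0 := by
      intro f
      simp only [eq_comm]
    simp only [this]
    rw [sum_collision y x hxy.symm (fun f => if f x' = f y' then 1 else 0),
      sum_collision_one x' y' hxy']
    intro f c
    rw [Function.update_of_ne hx, Function.update_of_ne h2.symm]
  · rw [sum_collision x y hxy (fun f => if f x' = f y' then 1 else 0),
      sum_collision_one x' y' hxy']
    intro f c
    rw [Function.update_of_ne h1, Function.update_of_ne (Ne.symm hy)]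

/-- With `s * |A|` large compared to `N`, a random function rarely has no collision between a
family of `s` elements and `A`. -/
theorem card_marked_eq_empty [NeZero N] {s : ℕ} (xs : Fin s → Fin N) (hxs : Function.Injective xs)
    (A : Finset (Fin N)) (hA : ∀ k, xs k ∉ A) :
    ((Finset.univ.filter fun f => marked f xs A = ∅).card : ℝ) * (s * A.card) ≤
      N * (N : ℝ) ^ N := by
  classical
  have hN' : (0 : ℝ) < N := Nat.cast_pos.2 (NeZero.pos N)
  set F : ℝ := (N : ℝ) ^ N with hF
  have hF0 : 0 < F := by positivity
  set I : Finset (Fin s × Fin N) := Finset.univ ×ˢ A with hI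
  set P : ℝ := s * A.card with hP
  have hP0 : 0 ≤ P := by positivity
  have hIc : (I.card : ℝ) = P := by simp [hI, hP]
  set ind : Fin s × Fin N → (Fin N → Fin N) → ℝ :=
    fun i f => if f (xs i.1) = f i.2 then 1 else 0 with hind
  set Z : (Fin N → Fin N) → ℝ := fun f => ∑ i ∈ I, ind i f with hZ
  have hneq : ∀ i ∈ I, ∀ i' ∈ I, xs i.1 ≠ i'.2 := by
    intro i _ i' hi' h
    rw [hI, Finset.mem_product] at hi'
    exact hA i.1 (h ▸ hi'.2)
  have h1 : ∀ i ∈ I, ∑ f, ind i f = F / N := by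
    intro i hi
    rw [eq_div_iff hN'.ne', mul_comm]
    exact sum_collision_one _ _ (hneq i hi i hi)
  have h2 : ∀ i ∈ I, ∀ i' ∈ I, ∑ f, ind i f * ind i' f ≤
      F / N ^ 2 + if i = i' then F / N else 0 := by
    intro i hi i' hi'
    by_cases h : i = i'
    · subst h
      have : ∀ f, ind i f * ind i f = ind i f := by
        intro f
        simp only [hind]
        split_ifs <;> simp
      simp only [this, h1 i hi, if_true]
      have : 0 ≤ F / N ^ 2 := by positivity
      linarith
    · have hne : xs i.1 ≠ xs i'.1 ∨ i.2 ≠ i'.2 := by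
        by_contra hcon
        push Not at hcon
        exact h (Prod.ext (hxs hcon.1) hcon.2)
      have := sum_collision_two (xs i.1) i.2 (xs i'.1) i'.2 (hneq i hi i hi)
        (hneq i' hi' i' hi') (hneq i' hi' i hi) (hneq i hi i' hi') hne
      have h3 : ∀ f, ind i f * ind i' f = if f (xs i.1) = f i.2 then
          if f (xs i'.1) = f i'.2 then (1 : ℝ) else 0 else 0 := by
        intro f
        simp only [hind]
        split_ifs <;> simp
      simp only [h3, h, if_false, add_zero]
      rw [le_div_iff₀ (by positivity)]
      nlinarith
  have hsum1 : ∑ f, Z f = P * (F / N) := by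
    simp only [hZ]
    rw [Finset.sum_comm, Finset.sum_congr rfl h1, Finset.sum_const, nsmul_eq_mul, hIc]
  have hsum2 : ∑ f, Z f ^ 2 ≤ P * P * (F / N ^ 2) + P * (F / N) := by
    have : ∀ f, Z f ^ 2 = ∑ i ∈ I, ∑ i' ∈ I, ind i f * ind i' f := by
      intro f
      rw [sq, hZ, Finset.sum_mul_sum]
    simp only [this]
    rw [Finset.sum_comm]
    have hle : ∀ i ∈ I, ∑ f, ∑ i' ∈ I, ind i f * ind i' f ≤ P * (F / N ^ 2) + F / N := by
      intro i hi
      rw [Finset.sum_comm]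
      refine (Finset.sum_le_sum fun i' hi' => h2 i hi i' hi').trans ?_
      rw [Finset.sum_add_distrib, Finset.sum_const, nsmul_eq_mul, hIc, Finset.sum_ite_eq,
        if_pos hi]
    refine (Finset.sum_le_sum hle).trans ?_
    rw [Finset.sum_const, nsmul_eq_mul, hIc]
    linarith
  have hcard : ∑ _f : Fin N → Fin N, (1 : ℝ) = F := by simp [hF]
  -- Chebyshev: the variance is at most the mean `P/N`, while a function without collisions deviates
  -- by the whole mean.
  have hvar : ∑ f, (Z f - P / N) ^ 2 ≤ P * (F / N) := by
    have : ∀ f, (Z f - P / N) ^ 2 = Z f ^ 2 - 2 * (P / N) * Z f + (P / N) ^ 2 * 1 := by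
      intro f
      ring
    simp only [this, Finset.sum_add_distrib, Finset.sum_sub_distrib, ← Finset.mul_sum, hsum1,
      hcard]
    have e : 2 * (P / N) * (P * (F / N)) = 2 * (P * P * (F / N ^ 2)) := by
      field_simp
    have e' : (P / N) ^ 2 * F = P * P * (F / N ^ 2) := by
      field_simp
    rw [e, e']
    linarith
  have hempty : ((Finset.univ.filter fun f => marked f xs A = ∅).card : ℝ) * (P / N) ^ 2 ≤
      ∑ f, (Z f - P / N) ^ 2 := by
    rw [← nsmul_eq_mul, ← Finset.sum_const]
    refine le_trans (Finset.sum_le_sum ?_)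
      (Finset.sum_le_sum_of_subset_of_nonneg (Finset.subset_univ _) fun f _ _ => sq_nonneg _)
    intro f hf
    have hf' : marked f xs A = ∅ := (Finset.mem_filter.1 hf).2
    have hZ0 : Z f = 0 := by
      refine Finset.sum_eq_zero fun i hi => ?_
      simp only [hind]
      rw [if_neg]
      intro h
      rw [hI, Finset.mem_product] at hi
      have : i.2 ∈ marked f xs A := (mem_marked f i.2).2 ⟨hi.2, i.1, h⟩
      rw [hf'] at this
      exact absurd this (Finset.notMem_empty _)
    rw [hZ0]
    exact le_of_eq (by ring)
  set c : ℝ := ((Finset.univ.filter fun f => marked f xs A = ∅).card : ℝ)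
  rcases hP0.eq_or_lt with h0 | h0
  · rw [← h0, mul_zero]
    positivity
  · have h3 := hempty.trans hvar
    have h4 : c * P * (P / N ^ 2) ≤ N * F * (P / N ^ 2) := by
      refine le_trans (le_of_eq ?_) (h3.trans (le_of_eq ?_))
      · field_simp
      · field_simp
    exact le_of_mul_le_mul_right h4 (by positivity)

/-- Suitable numbers of iterations for nine attempts to find a collision. -/
theorem exists_iterations [NeZero N] {s : ℕ} (xs : Fin s → Fin N)
    (hxs : Function.Injective xs) {A D : Finset (Fin N)} (hA : ∀ k, xs k ∉ A) (hAD : A ⊆ D)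
    (hD : D.Nonempty) (hcard : 2 * A.card ≤ D.card) {m : ℕ} (hm : D.card ≤ m ^ 2)
    (hs : 12 * N ≤ s * A.card) :
    ∃ js : Fin 9 → Fin m, ∑ f : Fin N → Fin N, ∏ r, (1 - ∑ y ∈ marked f xs A,
      amp D (marked f xs A) (js r) y ^ 2) ≤ (N : ℝ) ^ N / 6 := by
  classical
  have hN : 0 < N := NeZero.pos N
  have hN' : (0 : ℝ) < N := Nat.cast_pos.2 hN
  have hm0 : 0 < m := by
    rcases Nat.eq_zero_or_pos m with rfl | h
    · have := hD.card_pos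
      omega
    · exact h
  have : Nonempty (Fin m) := ⟨⟨0, hm0⟩⟩
  set q : (Fin N → Fin N) → Fin m → ℝ := fun f j =>
    1 - ∑ y ∈ marked f xs A, amp D (marked f xs A) j y ^ 2 with hq
  have hq0 : ∀ f j, 0 ≤ q f j := by
    intro f j
    have h1 : ∑ y ∈ marked f xs A, amp D (marked f xs A) j y ^ 2 ≤
        ∑ y, amp D (marked f xs A) j y ^ 2 :=
      Finset.sum_le_sum_of_subset_of_nonneg (Finset.subset_univ _) fun _ _ _ => sq_nonneg _
    rw [sum_amp_sq hD] at h1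
    simp only [hq]
    linarith
  set F : ℝ := (N : ℝ) ^ N with hF
  have hF0 : 0 < F := by positivity
  have hbound : ∀ f, (∑ j, q f j) ^ 9 ≤
      (m : ℝ) ^ 9 * (1 / 12 + if marked f xs A = ∅ then 1 else 0) := by
    intro f
    have hnn : 0 ≤ ∑ j, q f j := Finset.sum_nonneg fun j _ => hq0 f j
    have hsum : ∑ j, q f j =
        m - ∑ j ∈ Finset.range m, ∑ y ∈ marked f xs A, amp D (marked f xs A) j y ^ 2 := by
      simp only [hq, Finset.sum_sub_distrib, Finset.sum_const, Finset.card_univ,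
        Fintype.card_fin, nsmul_eq_mul, mul_one]
      rw [Fin.sum_univ_eq_sum_range
        (fun j => ∑ y ∈ marked f xs A, amp D (marked f xs A) j y ^ 2) m]
    by_cases he : marked f xs A = ∅
    · have h1 : ∑ j, q f j ≤ m := by
        rw [hsum, he]
        simp
      simp only [he, if_true]
      have := pow_le_pow_left₀ hnn h1 9
      have h2 : (0 : ℝ) ≤ (m : ℝ) ^ 9 := by positivity
      linarith
    · have hsub : marked f xs A ⊆ A := fun y hy => ((mem_marked f y).1 hy).1
      have h1 := le_sum_success (hsub.trans hAD) (Finset.nonempty_iff_ne_empty.2 he)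
        (by have := Finset.card_le_card hsub; omega) hm
      have h2 : ∑ j, q f j ≤ m * (3 / 4) := by
        rw [hsum]
        linarith
      simp only [he, if_false, add_zero]
      refine (pow_le_pow_left₀ hnn h2 9).trans ?_
      rw [mul_pow]
      refine mul_le_mul_of_nonneg_left ?_ (by positivity)
      norm_num
  have htotal : ∑ js : Fin 9 → Fin m, ∑ f, ∏ r, q f (js r) ≤
      ∑ _js : Fin 9 → Fin m, F / 6 := by
    rw [Finset.sum_comm]
    -- Summing over all choices of nine iteration numbers factorizes into a ninth power, to which
    -- `hbound` applies. The two terms 1/12 there come from `(3/4)^9` and from functions without a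
    -- collision.
    simp only [← Fintype.sum_pow]
    refine (Finset.sum_le_sum fun f _ => hbound f).trans ?_
    rw [← Finset.mul_sum, Finset.sum_add_distrib, Finset.sum_const, Finset.sum_const]
    simp only [Finset.card_univ, Fintype.card_fun, Fintype.card_fin, nsmul_eq_mul, Nat.cast_pow]
    refine mul_le_mul_of_nonneg_left ?_ (by positivity)
    rw [← hF, Finset.sum_ite, Finset.sum_const_zero, add_zero, Finset.sum_const, nsmul_eq_mul,
      mul_one]
    have h1 := card_marked_eq_empty xs hxs A hA
    have h2 : (12 * N : ℝ) ≤ s * A.card := by exact_mod_cast hs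
    set c : ℝ := ((Finset.univ.filter fun f => marked f xs A = ∅).card : ℝ) with hc
    have hc0 : 0 ≤ c := by positivity
    have h3 : N * (c * 12) ≤ N * F := by
      refine le_trans (le_of_eq ?_) ((mul_le_mul_of_nonneg_left h2 hc0).trans h1)
      ring
    have h4 := le_of_mul_le_mul_left h3 hN'
    linarith
  obtain ⟨js, -, hjs⟩ := Finset.exists_le_of_sum_le Finset.univ_nonempty htotal
  exact ⟨js, hjs⟩

end Random

/-! ### The complete algorithm -/

section Search

variable {N S s Bt J : ℕ} [NeZero N] (L : Reg (width N) s ↪ Fin S) (xs : Fin Bt → Fin s → Fin N)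
  (A : Fin J → Finset (Fin N)) {D : Fin J → Finset (Fin N)} (hD : ∀ j, (D j).Nonempty)
  (h0 : ∀ j, (0 : Fin N) ∉ D j) {m : ℕ} (js : Fin Bt → Fin J → Fin 9 → Fin m)

/-- For each of the families `xs b`: load its values into the table, and then search each of the
sets `A j` for collisions with it. -/
noncomputable def search : Circuit N S :=
  (List.finRange Bt).flatMap fun b => load L (xs b) ++
    (List.finRange J).flatMap fun j => (List.finRange 9).flatMap fun r =>
      attempt L (xs b) (A j) (hD j) (h0 j) (js b j r)

theorem queries_search_le :
    (search L xs A hD h0 js).queries ≤ Bt * (s + J * (9 * (2 * m + 1))) := by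
  have h1 : ∀ b j, List.countP Gate.isQuery ((List.finRange 9).flatMap fun r =>
      attempt L (xs b) (A j) (hD j) (h0 j) (js b j r)) ≤ 9 * (2 * m + 1) := by
    intro b j
    rw [List.countP_flatMap]
    refine (List.sum_le_card_nsmul _ (2 * m + 1) ?_).trans (by simp)
    intro x hx
    obtain ⟨r, -, rfl⟩ := List.mem_map.1 hx
    have := queries_attempt L (xs b) (A j) (hD j) (h0 j) (js b j r)
    rw [Circuit.queries] at this
    simp only [Function.comp_def, this]
    have := (js b j r).2
    omega
  have h2 : ∀ b, List.countP Gate.isQuery (load L (xs b) ++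
      (List.finRange J).flatMap fun j => (List.finRange 9).flatMap fun r =>
        attempt L (xs b) (A j) (hD j) (h0 j) (js b j r)) ≤ s + J * (9 * (2 * m + 1)) := by
    intro b
    have h3 := queries_load L (xs b)
    rw [Circuit.queries] at h3
    rw [List.countP_append, h3, List.countP_flatMap]
    refine Nat.add_le_add_left ((List.sum_le_card_nsmul _ (9 * (2 * m + 1)) ?_).trans
      (by simp)) s
    intro x hx
    obtain ⟨j, -, rfl⟩ := List.mem_map.1 hx
    exact h1 b j
  rw [Circuit.queries, search, List.countP_flatMap]
  refine (List.sum_le_card_nsmul _ (s + J * (9 * (2 * m + 1))) ?_).trans (by simp)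
  intro x hx
  obtain ⟨b, -, rfl⟩ := List.mem_map.1 hx
  exact h2 b

theorem le_prob_search (f : Fin N → Fin N) (cell : ℕ × ℕ → Fin Bt × Fin J)
    (hcell : ∀ b j k, ∀ y ∈ A j, xs b k < y ∧ cell ((xs b k).val, y.val) = (b, j)) {K : ℕ}
    (hK : K ≤ Bt * J) :
    1 - (∑ b, ∑ j, ∏ r, (1 - ∑ y ∈ marked f (xs b) (A j),
        amp (D j) (marked f (xs b) (A j)) (js b j r) y ^ 2)) / ((Bt * J : ℕ) - K + 1 : ℝ) ≤
      prob f (search L xs A hD h0 js) (initialState S) (Solves f K) := by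
  classical
  set Ok : ℕ × ℕ → Prop := fun p => ∃ a b : Fin N, p = (a.val, b.val) ∧ a < b ∧ f a = f b
    with hOk
  set ε : Fin Bt → Fin J → ℝ := fun b j => ∏ r, (1 - ∑ y ∈ marked f (xs b) (A j),
    amp (D j) (marked f (xs b) (A j)) (js b j r) y ^ 2) with hε
  have hpiece : ∀ b j, Segment f Ok cell ((List.finRange 9).flatMap fun r =>
      attempt L (xs b) (A j) (hD j) (h0 j) (js b j r)) (base L fun k => enc (f (xs b k)))
      (base L fun k => enc (f (xs b k))) {(b, j)} (ε b j) := by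
    intro b j
    have h1 := Trial.flatMap (fun r => trial_attempt (f := f) L (xs b) (A j) (hD j) (h0 j)
      (js b j r) (fun p => Ok p ∧ cell p = (b, j)) fun k y hy hf =>
        ⟨⟨xs b k, y, rfl, (hcell b j k y hy).1, hf⟩, (hcell b j k y hy).2⟩) (fun r => by
      have h2 : ∑ y ∈ marked f (xs b) (A j),
          amp (D j) (marked f (xs b) (A j)) (js b j r) y ^ 2 ≤
          ∑ y, amp (D j) (marked f (xs b) (A j)) (js b j r) y ^ 2 :=
        Finset.sum_le_sum_of_subset_of_nonneg (Finset.subset_univ _) fun _ _ _ => sq_nonneg _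
      rw [sum_amp_sq (hD j)] at h2
      linarith) (List.finRange 9)
    rw [← Fin.prod_univ_def] at h1
    exact h1.segment (b, j) fun p hp => hp
  have hbatch : ∀ b (σ : Fin S → Bool), True → ∃ σ', True ∧ Segment f Ok cell (load L (xs b) ++
      (List.finRange J).flatMap fun j => (List.finRange 9).flatMap fun r =>
        attempt L (xs b) (A j) (hD j) (h0 j) (js b j r)) σ σ'
      ((List.finRange J).toFinset.biUnion fun j => {(b, j)}) (∑ j, ε b j) := by
    intro b σ _
    -- Within a batch the invariant is the exact table state. Between batches no invariant is
    -- needed, since `load` resets all qubits.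
    obtain ⟨σ', -, h1⟩ := Segment.flatMap (f := f) (Ok := Ok) (cell := cell)
      (fun σ => σ = base L fun k => enc (f (xs b k)))
      (fun j σ hσ => ⟨σ, hσ, by rw [hσ]; exact hpiece b j⟩) (List.finRange J) _ rfl
    refine ⟨σ', trivial, ?_⟩
    have h2 := (segment_load L (xs b) σ).append h1
    rw [Finset.empty_union, zero_add, ← Fin.sum_univ_def] at h2
    exact h2
  obtain ⟨σ', -, h⟩ := Segment.flatMap (fun _ => True) hbatch (List.finRange Bt)
    (fun _ => false) trivial
  rw [← Fin.sum_univ_def] at h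
  have hP : ((List.finRange Bt).toFinset.biUnion fun b =>
      (List.finRange J).toFinset.biUnion fun j => ({(b, j)} : Finset (Fin Bt × Fin J))) =
      Finset.univ := by
    ext ⟨b, j⟩
    simp
  rw [hP] at h
  have hc : (Finset.univ : Finset (Fin Bt × Fin J)).card = Bt * J := by simp
  have := h.le_prob_solves (fun p hp => hp) (K := K) (by rw [hc]; exact hK)
  rw [hc] at this
  exact this

end Search

/-- The numbers below `h` hold the batches, and block `j` starts at `h + 2nj`. Since `h ≥ 1`, the
point `0` lies in no block, as state preparation requires. -/
theorem exists_circuit {N K S s n h J Bt m : ℕ} (hK : 1 ≤ K) (hS : 3 * width N + 1 + s * width N ≤ S)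
    (hs : 1 ≤ s) (hn : 1 ≤ n) (hh : 1 ≤ h) (hB : Bt * s ≤ h) (hJ : h + 2 * n * J ≤ N)
    (hsn : 12 * N ≤ s * n) (hm : 2 * n ≤ m ^ 2) (hBJ : 2 * K ≤ Bt * J) :
    ∃ C : Circuit N S, 2 / 3 ≤ successProb C K ∧
      C.queries ≤ Bt * (s + J * (9 * (2 * m + 1))) := by
  classical
  have hBJ0 : 0 < Bt * J := by omega
  have hB0 : 0 < Bt := Nat.pos_of_mul_pos_right hBJ0
  have hJ0 : 0 < J := Nat.pos_of_mul_pos_left hBJ0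
  have : NeZero N := ⟨by omega⟩
  obtain ⟨L⟩ : Nonempty (Reg (width N) s ↪ Fin S) := by
    refine Function.Embedding.nonempty_of_card_le ?_
    simp only [Fintype.card_sum, Fintype.card_fin, Fintype.card_prod, Fintype.card_unit]
    omega
  have hlt : ∀ (b : Fin Bt) (k : Fin s), b.val * s + k.val < h := by
    intro b k
    have h1 : (b.val + 1) * s ≤ Bt * s := Nat.mul_le_mul_right s b.2
    have h2 := k.2
    rw [add_mul] at h1
    omega
  have hpiece : ∀ j : Fin J, h + 2 * n * j.val + 2 * n ≤ N := by
    intro j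
    have h1 : 2 * n * (j.val + 1) ≤ 2 * n * J := Nat.mul_le_mul_left _ j.2
    rw [mul_add] at h1
    omega
  set xs : Fin Bt → Fin s → Fin N := fun b k => ⟨b.val * s + k.val, by
    have := hlt b k
    omega⟩ with hxs
  set D : Fin J → Finset (Fin N) := fun j =>
    (Finset.Ico (h + 2 * n * j.val) (h + 2 * n * j.val + 2 * n)).attachFin (by
      intro a ha
      have := hpiece j
      have := (Finset.mem_Ico.1 ha).2
      omega) with hDdef
  set A : Fin J → Finset (Fin N) := fun j =>
    (Finset.Ico (h + 2 * n * j.val) (h + 2 * n * j.val + n)).attachFin (by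
      intro a ha
      have := hpiece j
      have := (Finset.mem_Ico.1 ha).2
      omega) with hAdef
  have hDc : ∀ j, (D j).card = 2 * n := by
    intro j
    simp [hDdef]
  have hAc : ∀ j, (A j).card = n := by
    intro j
    simp [hAdef]
  have hmemA : ∀ j y, y ∈ A j ↔ h + 2 * n * j.val ≤ y.val ∧ y.val < h + 2 * n * j.val + n := by
    intro j y
    simp [hAdef]
  have hmemD : ∀ j y, y ∈ D j ↔
      h + 2 * n * j.val ≤ y.val ∧ y.val < h + 2 * n * j.val + 2 * n := by
    intro j y
    simp [hDdef]
  have hD : ∀ j, (D j).Nonempty := by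
    intro j
    rw [← Finset.card_pos, hDc]
    omega
  have h0 : ∀ j, (0 : Fin N) ∉ D j := by
    intro j hj
    have := ((hmemD j 0).1 hj).1
    simp only [Fin.val_zero] at this
    omega
  have hxlt : ∀ b k j, ∀ y ∈ A j, xs b k < y := by
    intro b k j y hy
    have h1 := ((hmemA j y).1 hy).1
    have h2 := hlt b k
    rw [Fin.lt_def]
    simp only [hxs]
    omega
  have hex : ∀ b j, ∃ js : Fin 9 → Fin m, ∑ f : Fin N → Fin N,
      ∏ r, (1 - ∑ y ∈ marked f (xs b) (A j),
        amp (D j) (marked f (xs b) (A j)) (js r) y ^ 2) ≤ (N : ℝ) ^ N / 6 := by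
    intro b j
    refine exists_iterations (xs b) ?_ ?_ ?_ (hD j) ?_ ?_ ?_
    · intro k k' hkk
      simp only [hxs, Fin.mk.injEq] at hkk
      exact Fin.ext (by omega)
    · intro k hk
      exact lt_irrefl _ (hxlt b k j _ hk)
    · intro y hy
      rw [hmemA] at hy
      rw [hmemD]
      omega
    · rw [hAc, hDc]
    · rw [hDc]
      exact hm
    · rw [hAc]
      exact hsn
  choose js hjs using hex
  -- Division recovers batch and block from the points of a pair; the remainders only make the map
  -- total.
  set cell : ℕ × ℕ → Fin Bt × Fin J := fun p =>
    (⟨p.1 / s % Bt, Nat.mod_lt _ hB0⟩, ⟨(p.2 - h) / (2 * n) % J, Nat.mod_lt _ hJ0⟩) with hcelldef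
  have hcell : ∀ b j k, ∀ y ∈ A j, xs b k < y ∧ cell ((xs b k).val, y.val) = (b, j) := by
    intro b j k y hy
    refine ⟨hxlt b k j y hy, ?_⟩
    rw [hmemA] at hy
    have h1 : (b.val * s + k.val) / s = b.val := by
      rw [mul_comm, Nat.mul_add_div (by omega), Nat.div_eq_of_lt k.2, add_zero]
    have h2 : (y.val - h) / (2 * n) = j.val := by
      have h3 : y.val - h = 2 * n * j.val + (y.val - h - 2 * n * j.val) := by omega
      rw [h3, Nat.mul_add_div (by omega), Nat.div_eq_of_lt (by omega), add_zero]
    simp only [hcelldef, hxs, Prod.mk.injEq]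
    exact ⟨Fin.ext (by simp [h1, Nat.mod_eq_of_lt b.2]),
      Fin.ext (by simp [h2, Nat.mod_eq_of_lt j.2])⟩
  refine ⟨search L xs A hD h0 js, ?_, queries_search_le L xs A hD h0 js⟩
  have hN : (0 : ℝ) < N := Nat.cast_pos.2 (NeZero.pos N)
  set F : ℝ := (N : ℝ) ^ N with hF
  have hF0 : 0 < F := by positivity
  have hcard : (Fintype.card (Fin N → Fin N) : ℝ) = F := by simp [hF]
  set W : ℝ := ((Bt * J : ℕ) : ℝ) with hW
  have hW2 : 2 * (K : ℝ) ≤ W := by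
    rw [hW]
    exact_mod_cast hBJ
  have hden : 0 < W - K + 1 := by
    have : (0 : ℝ) ≤ K := Nat.cast_nonneg K
    linarith
  rw [successProb, hcard, le_div_iff₀ hF0]
  refine le_trans ?_ (Finset.sum_le_sum fun f _ =>
    le_prob_search L xs A hD h0 js f cell hcell (K := K) (by omega))
  rw [Finset.sum_sub_distrib, ← Finset.sum_div]
  have h1 : ∑ _f : Fin N → Fin N, (1 : ℝ) = F := by simp [hF]
  rw [h1, Finset.sum_comm]
  have h2 : ∑ b, ∑ f : Fin N → Fin N, ∑ j, ∏ r, (1 - ∑ y ∈ marked f (xs b) (A j),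
      amp (D j) (marked f (xs b) (A j)) (js b j r) y ^ 2) ≤ W * (F / 6) := by
    have h3 : ∀ b ∈ (Finset.univ : Finset (Fin Bt)), ∑ f : Fin N → Fin N, ∑ j,
        ∏ r, (1 - ∑ y ∈ marked f (xs b) (A j),
        amp (D j) (marked f (xs b) (A j)) (js b j r) y ^ 2) ≤ J * (F / 6) := by
      intro b _
      rw [Finset.sum_comm]
      refine (Finset.sum_le_sum fun j _ => hjs b j).trans (by simp)
    refine (Finset.sum_le_sum h3).trans ?_
    simp only [Finset.sum_const, Finset.card_univ, Fintype.card_fin, nsmul_eq_mul, hW,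
      Nat.cast_mul]
    exact le_of_eq (by ring)
  -- On average at most `W/6` cells fail, and `W - K + 1 ≥ W/2` because `2K ≤ W`.
  have h4 : (∑ b, ∑ f : Fin N → Fin N, ∑ j, ∏ r, (1 - ∑ y ∈ marked f (xs b) (A j),
      amp (D j) (marked f (xs b) (A j)) (js b j r) y ^ 2)) / (W - K + 1) ≤ F / 3 := by
    rw [div_le_iff₀ hden]
    refine h2.trans ?_
    nlinarith
  linarith

/-! ### Choice of the parameters -/

theorem exists_circuit_of_table {N K S s : ℕ} (hK : 1 ≤ K) (hKN : 10 ^ 9 * K ≤ N)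
    (hS : 3 * width N + 1 + s * width N ≤ S) (hs : 104 ≤ s) (hs3 : s ^ 3 ≤ K ^ 2 * N) :
    ∃ C : Circuit N S, 2 / 3 ≤ successProb C K ∧
      (C.queries : ℝ) ≤ 3000 * (K * Real.sqrt (N / s)) := by
  have hN : 1 ≤ N := by omega
  have hsN : 10 ^ 4 * s ≤ N := by
    by_contra hcon
    push Not at hcon
    have h1 : N ^ 3 ≤ (10 ^ 4 * s) ^ 3 := Nat.pow_le_pow_left hcon.le 3
    have h2 : (10 ^ 9 * K) ^ 2 * N ≤ N ^ 2 * N :=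
      Nat.mul_le_mul_right N (Nat.pow_le_pow_left hKN 2)
    have h3 : 1 ≤ K ^ 2 * N := Nat.mul_pos (by positivity) hN
    nlinarith
  obtain ⟨n, hn⟩ : ∃ n, n = 12 * N / s + 1 := ⟨_, rfl⟩
  -- As `s * n ≤ 13 * N`, the bound `104 * J ≤ s` keeps all blocks within `N/4` points; more than
  -- `2K` blocks are never needed.
  obtain ⟨J, hJ⟩ : ∃ J, J = min (s / 104) (2 * K) := ⟨_, rfl⟩
  obtain ⟨Bt, hBt⟩ : ∃ Bt, Bt = 2 * K / J + 1 := ⟨_, rfl⟩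
  obtain ⟨m, hm⟩ : ∃ m, m = Nat.sqrt (2 * n) + 1 := ⟨_, rfl⟩
  have hsn : 12 * N ≤ s * n := by
    have := Nat.lt_mul_div_succ (12 * N) (show 0 < s by omega)
    rw [hn]
    exact this.le
  have hsn' : s * n ≤ 13 * N := by
    have := Nat.mul_div_le (12 * N) s
    rw [hn, mul_add]
    omega
  have hn1 : 1 ≤ n := hn ▸ Nat.le_add_left 1 _
  have hBt0 : 1 ≤ Bt := hBt ▸ Nat.le_add_left 1 _
  clear hn
  have hJ1 : 1 ≤ J := by omega
  have hJs : 104 * J ≤ s := by omega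
  have hBJ : 2 * K ≤ Bt * J := by
    have := Nat.lt_mul_div_succ (2 * K) hJ1
    rw [hBt, mul_comm (_ + 1) J]
    exact this.le
  have hBJ' : Bt * J ≤ 4 * K := by
    have := Nat.div_mul_le_self (2 * K) J
    rw [hBt, add_mul]
    omega
  have hBs : Bt * s ≤ 2 * s + 832 * K := by
    -- Either `J = 2K` and two batches are used, or `s ≤ 208 * J` and loading costs only a constant
    -- per cell.
    by_cases hc : 2 * K ≤ s / 104
    · have h1 : J = 2 * K := by omega
      have h2 : Bt = 2 := by rw [hBt, h1, Nat.div_self (by omega)]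
      rw [h2]
      omega
    · have h1 : s ≤ 208 * J := by omega
      have := Nat.mul_le_mul_left Bt h1
      have h2 : Bt * (208 * J) = 208 * (Bt * J) := by ring
      omega
  have hnJ : 2 * n * J ≤ N / 2 := by
    have h1 : n * (104 * J) ≤ n * s := Nat.mul_le_mul_left n hJs
    have h2 : 52 * (2 * n * J) = n * (104 * J) := by ring
    have h3 : n * s = s * n := mul_comm n s
    omega
  have hm1 : 2 * n ≤ m ^ 2 := by
    rw [hm]
    exact (Nat.lt_succ_sqrt' (2 * n)).le
  have hm2 : m ^ 2 ≤ 8 * n := by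
    have h1 : 1 ≤ Nat.sqrt (2 * n) := Nat.sqrt_pos.2 (by omega)
    have h2 := Nat.sqrt_le' (2 * n)
    have h3 : m ^ 2 ≤ (2 * Nat.sqrt (2 * n)) ^ 2 := Nat.pow_le_pow_left (by omega) 2
    rw [mul_pow] at h3
    omega
  have hBt1 : 1 ≤ Bt * s := Nat.mul_pos hBt0 (by omega)
  obtain ⟨C, hC, hq⟩ := exists_circuit (N := N) (K := K) (S := S) (s := s) (n := n) (h := Bt * s)
    (J := J) (Bt := Bt) (m := m) hK hS (by omega) hn1 hBt1 le_rfl (by omega) hsn hm1 hBJ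
  refine ⟨C, hC, ?_⟩
  have hs0 : (0 : ℝ) < s := Nat.cast_pos.2 (by omega)
  have hN0 : (0 : ℝ) < N := Nat.cast_pos.2 hN
  set R := Real.sqrt (N / s) with hR
  have hRsq : R ^ 2 = N / s := Real.sq_sqrt (by positivity)
  have hR0 : 0 ≤ R := Real.sqrt_nonneg _
  have hR1 : 1 ≤ R := by
    rw [hR, Real.one_le_sqrt, one_le_div hs0]
    exact_mod_cast (by omega : s ≤ N)
  have hmR : (m : ℝ) ≤ 11 * R := by
    refine (sq_le_sq₀ (by positivity) (by positivity)).1 ?_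
    rw [mul_pow, hRsq]
    have h1 : s * m ^ 2 ≤ 104 * N := by
      have := Nat.mul_le_mul_left s hm2
      have h2 : s * (8 * n) = 8 * (s * n) := by ring
      omega
    have h2 : (s : ℝ) * (m : ℝ) ^ 2 ≤ 104 * N := by exact_mod_cast h1
    rw [← mul_div_assoc, le_div_iff₀ hs0]
    linarith
  have hK0 : (1 : ℝ) ≤ K := by exact_mod_cast hK
  -- Equivalent to `s³ ≤ K² N`: loading a batch costs no more than the target bound.
  have hsR : (s : ℝ) ≤ K * R := by
    refine (sq_le_sq₀ (by positivity) (by positivity)).1 ?_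
    rw [mul_pow, hRsq, ← mul_div_assoc, le_div_iff₀ hs0]
    have : (s : ℝ) ^ 3 ≤ (K : ℝ) ^ 2 * N := by exact_mod_cast hs3
    linarith
  have hKR : (K : ℝ) ≤ K * R := le_mul_of_one_le_right (by linarith) hR1
  have hq' : C.queries ≤ 2 * s + 832 * K + 108 * (K * m) := by
    have hm0 : 1 ≤ m := by omega
    have h1 : Bt * (s + J * (9 * (2 * m + 1))) = Bt * s + Bt * J * (9 * (2 * m + 1)) := by ring
    have h2 : Bt * J * (9 * (2 * m + 1)) ≤ 4 * K * (27 * m) :=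
      Nat.mul_le_mul hBJ' (by omega)
    have h3 : 4 * K * (27 * m) = 108 * (K * m) := by ring
    omega
  have hq'' : (C.queries : ℝ) ≤ 2 * s + 832 * K + 108 * (K * m) := by exact_mod_cast hq'
  have hKm : (K : ℝ) * m ≤ 11 * (K * R) := by
    have := mul_le_mul_of_nonneg_left hmR (by linarith : (0 : ℝ) ≤ K)
    linarith
  linarith

theorem width_le_log {N : ℕ} (hN : 3 ≤ N) : (width N : ℝ) ≤ 3 * Real.log N := by
  have hlog : 1 ≤ Real.log N := by
    rw [Real.le_log_iff_exp_le (by positivity)]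
    have : (3 : ℝ) ≤ N := by exact_mod_cast hN
    linarith [Real.exp_one_lt_d9]
  have h1 : 2 ^ (width N - 1) < N := Nat.pow_pred_clog_lt_self (by norm_num) (by omega)
  have h2 : ((width N - 1 : ℕ) : ℝ) * Real.log 2 ≤ Real.log N := by
    rw [← Real.log_pow]
    refine Real.log_le_log (by positivity) ?_
    exact_mod_cast h1.le
  have h3 : (width N : ℝ) ≤ ((width N - 1 : ℕ) : ℝ) + 1 := by
    exact_mod_cast (by omega : width N ≤ width N - 1 + 1)
  have h4 := Real.log_two_gt_d9
  have h5 : (0 : ℝ) ≤ ((width N - 1 : ℕ) : ℝ) := Nat.cast_nonneg _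
  nlinarith

/-- The number of entries of the table. -/
theorem exists_table_size {N K S : ℕ} {A : ℝ} {b : ℕ} (hA : 0 < A) (hK : 1 ≤ K)
    (hKN : 10 ^ 9 * K ≤ N) (hS : 1000 * Real.log N ≤ S)
    (hSA : (S : ℝ) ≤ A * ((K : ℝ) ^ (2 / 3 : ℝ) * (N : ℝ) ^ (1 / 3 : ℝ)) * Real.log N ^ b) :
    ∃ s : ℕ, 104 ≤ s ∧ s ^ 3 ≤ K ^ 2 * N ∧ 3 * width N + 1 + s * width N ≤ S ∧
      (S : ℝ) ≤ s * ((6 + 2 * A) * Real.log N ^ (b + 1)) := by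
  have hN : 10 ^ 9 ≤ N := by omega
  have hNR : (10 : ℝ) ^ 9 ≤ N := by exact_mod_cast hN
  have hlog : 1 ≤ Real.log N := by
    rw [Real.le_log_iff_exp_le (by linarith)]
    linarith [Real.exp_one_lt_d9]
  have hw := width_le_log (by omega : 3 ≤ N)
  have hw1 : 1 ≤ width N := Nat.clog_pos (by norm_num) (by omega)
  have hw1' : (1 : ℝ) ≤ width N := by exact_mod_cast hw1
  set ℓ := Real.log N with hℓ
  set w := width N with hwdef
  set Q : ℝ := (K : ℝ) ^ (2 / 3 : ℝ) * (N : ℝ) ^ (1 / 3 : ℝ) with hQ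
  have hQ0 : 0 ≤ Q := by positivity
  have hQ3 : Q ^ 3 = (K : ℝ) ^ 2 * N := by
    rw [hQ, mul_pow, ← Real.rpow_mul_natCast (by positivity), ← Real.rpow_mul_natCast (by positivity)]
    norm_num
  have hQ1 : 1000 ≤ Q := by
    refine le_of_pow_le_pow_left₀ (n := 3) (by norm_num) hQ0 ?_
    rw [hQ3]
    have : (1 : ℝ) ≤ (K : ℝ) ^ 2 := one_le_pow₀ (by exact_mod_cast hK)
    nlinarith
  have hSw : 333 * (w : ℝ) ≤ S := by linarith
  have hSw' : 333 * w ≤ S := by exact_mod_cast hSw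
  -- `s₁` is the number of entries that fit into the memory, `s₂` the cap imposed by `s³ ≤ K² N`. If
  -- `s₁` is smaller, `S ≤ 6 s₁ log N`; otherwise the upper bound on `S` gives `S ≤ 2A s₂ (log
  -- N)^b`.
  obtain ⟨s₁, hs₁⟩ : ∃ s₁, s₁ = (S - 3 * w - 1) / w := ⟨_, rfl⟩
  obtain ⟨s₂, hs₂⟩ : ∃ s₂, s₂ = ⌊Q⌋₊ := ⟨_, rfl⟩
  have h1a : s₁ * w ≤ S - 3 * w - 1 := by
    rw [hs₁]
    exact Nat.div_mul_le_self _ _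
  have h1b : S - 3 * w - 1 < w * (s₁ + 1) := by
    rw [hs₁]
    exact Nat.lt_mul_div_succ _ hw1
  have h1c : S ≤ 2 * (s₁ * w) := by
    have : w * (s₁ + 1) = s₁ * w + w := by ring
    omega
  have h1d : 104 ≤ s₁ := by
    by_contra hcon
    push Not at hcon
    have : s₁ * w ≤ 104 * w := Nat.mul_le_mul_right w hcon.le
    omega
  have h2a : (s₂ : ℝ) ≤ Q := by
    rw [hs₂]
    exact Nat.floor_le hQ0
  have h2b : Q ≤ 2 * s₂ := by
    have := Nat.lt_floor_add_one Q
    rw [← hs₂] at this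
    linarith
  have h2c : 104 ≤ s₂ := by
    have : (104 : ℝ) ≤ s₂ := by linarith
    exact_mod_cast this
  have hpow : 1 ≤ ℓ ^ b := one_le_pow₀ hlog
  have hpow1 : ℓ ≤ ℓ ^ (b + 1) := by
    rw [pow_succ]
    nlinarith
  have hpow2 : ℓ ^ b ≤ ℓ ^ (b + 1) := by
    rw [pow_succ]
    nlinarith
  have hpow0 : 0 ≤ ℓ ^ (b + 1) := by positivity
  refine ⟨min s₁ s₂, by omega, ?_, ?_, ?_⟩
  · have h : ((min s₁ s₂ : ℕ) : ℝ) ≤ Q := le_trans (by exact_mod_cast min_le_right _ _) h2a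
    have := pow_le_pow_left₀ (by positivity) h 3
    rw [hQ3] at this
    exact_mod_cast this
  · have : min s₁ s₂ * w ≤ s₁ * w := Nat.mul_le_mul_right w (min_le_left _ _)
    omega
  · rcases le_total s₁ s₂ with h | h
    · rw [min_eq_left h]
      have h1 : (S : ℝ) ≤ 2 * (s₁ * w) := by exact_mod_cast h1c
      have h2 : (s₁ : ℝ) * w ≤ s₁ * (3 * ℓ) := mul_le_mul_of_nonneg_left hw (Nat.cast_nonneg _)
      have h3 : (s₁ : ℝ) * (6 * ℓ) ≤ s₁ * ((6 + 2 * A) * ℓ ^ (b + 1)) := by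
        refine mul_le_mul_of_nonneg_left ?_ (Nat.cast_nonneg _)
        nlinarith
      linarith
    · rw [min_eq_right h]
      have h1 : A * Q * ℓ ^ b ≤ A * (2 * s₂) * ℓ ^ b := by
        gcongr
      have h3 : (s₂ : ℝ) * (2 * A * ℓ ^ b) ≤ s₂ * ((6 + 2 * A) * ℓ ^ (b + 1)) := by
        refine mul_le_mul_of_nonneg_left ?_ (Nat.cast_nonneg _)
        nlinarith
      linarith

end CollisionSearch

theorem proposition6p6 :
    ∃ c C : ℝ, 0 < c ∧ 0 < C ∧
      ∀ (A : ℝ) (b : ℕ), 0 < A →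
        ∃ (B : ℝ) (d : ℕ), 0 < B ∧
          ∀ N K S : ℕ, 1 ≤ K → (K : ℝ) ≤ c * N →
            C * Real.log N ≤ S →
            (S : ℝ) ≤ A * ((K : ℝ) ^ (2 / 3 : ℝ) * (N : ℝ) ^ (1 / 3 : ℝ)) * Real.log N ^ b →
            ∃ 𝒞 : CollisionSearch.Circuit N S,
              2 / 3 ≤ CollisionSearch.successProb 𝒞 K ∧
              (𝒞.queries : ℝ) ≤ B * (K * Real.sqrt (N / S)) * Real.log N ^ d ∧
              (𝒞.queries : ℝ) ^ 2 * S ≤ B * ((K : ℝ) ^ 2 * N) * Real.log N ^ d := by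
  -- The factor `(6 + 2A) (log N)^(b+1)` bounds `S/s`, and `3000` is the constant of
  -- `exists_circuit_of_table`. It is squared so that the same `B` serves both bounds.
  refine ⟨1 / 10 ^ 9, 1000, by norm_num, by norm_num, fun A b hA =>
    ⟨3000 ^ 2 * (6 + 2 * A), b + 1, by positivity, fun N K S hK hKc hS hSA => ?_⟩⟩
  have hKN : 10 ^ 9 * K ≤ N := by
    have : (10 : ℝ) ^ 9 * K ≤ N := by linarith
    exact_mod_cast this
  obtain ⟨s, hs, hs3, hsS, hSs⟩ := CollisionSearch.exists_table_size hA hK hKN hS hSA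
  obtain ⟨𝒞, hsucc, hq⟩ := CollisionSearch.exists_circuit_of_table hK hKN hsS hs hs3
  refine ⟨𝒞, hsucc, ?_⟩
  have hs0 : (0 : ℝ) < s := Nat.cast_pos.2 (by omega)
  have hS0 : (0 : ℝ) < S := by
    have h1 : s * 1 ≤ s * CollisionSearch.width N :=
      Nat.mul_le_mul_left s (Nat.clog_pos (by norm_num) (by omega))
    exact Nat.cast_pos.2 (by omega)
  have hlog : 1 ≤ Real.log N := by
    have : (10 : ℝ) ^ 9 ≤ N := by exact_mod_cast (by omega : 10 ^ 9 ≤ N)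
    rw [Real.le_log_iff_exp_le (by linarith)]
    linarith [Real.exp_one_lt_d9]
  have hpow : 1 ≤ Real.log N ^ (b + 1) := one_le_pow₀ hlog
  set Λ := (6 + 2 * A) * Real.log N ^ (b + 1) with hΛ
  have hΛ1 : 1 ≤ Λ := by nlinarith
  have hdiv : (N : ℝ) / s ≤ Λ * (N / S) := by
    rw [← mul_div_assoc, div_le_div_iff₀ hs0 hS0]
    have := mul_le_mul_of_nonneg_left hSs (Nat.cast_nonneg N : (0 : ℝ) ≤ N)
    linarith
  have hK0 : (0 : ℝ) ≤ K := Nat.cast_nonneg K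
  constructor
  · have h1 : Real.sqrt (N / s) ≤ Λ * Real.sqrt (N / S) := by
      refine (Real.sqrt_le_sqrt hdiv).trans ?_
      rw [Real.sqrt_mul (by linarith)]
      refine mul_le_mul_of_nonneg_right ?_ (Real.sqrt_nonneg _)
      -- `√Λ ≤ Λ` because `Λ ≥ 1`; a logarithmic power is given away here.
      rw [Real.sqrt_le_left (by linarith)]
      nlinarith
    have h2 : (K : ℝ) * Real.sqrt (N / s) ≤ K * (Λ * Real.sqrt (N / S)) :=
      mul_le_mul_of_nonneg_left h1 hK0
    have h3 : 0 ≤ (K : ℝ) * (Λ * Real.sqrt (N / S)) := by positivity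
    have h4 : 3000 ^ 2 * (6 + 2 * A) * (K * Real.sqrt (N / S)) * Real.log N ^ (b + 1) =
        3000 ^ 2 * (K * (Λ * Real.sqrt (N / S))) := by
      rw [hΛ]
      ring
    rw [h4]
    linarith
  · have h1 := pow_le_pow_left₀ (Nat.cast_nonneg _) hq 2
    rw [mul_pow, mul_pow, Real.sq_sqrt (by positivity)] at h1
    have h2 : (N : ℝ) / s * S ≤ N * Λ := by
      have := mul_le_mul_of_nonneg_right hdiv hS0.le
      rw [mul_assoc, div_mul_cancel₀ _ hS0.ne'] at this
      linarith
    calc (𝒞.queries : ℝ) ^ 2 * S ≤ 3000 ^ 2 * ((K : ℝ) ^ 2 * (N / s)) * S :=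
          mul_le_mul_of_nonneg_right h1 hS0.le
      _ = 3000 ^ 2 * (K : ℝ) ^ 2 * (N / s * S) := by ring
      _ ≤ 3000 ^ 2 * (K : ℝ) ^ 2 * (N * Λ) := mul_le_mul_of_nonneg_left h2 (by positivity)
      _ = _ := by
        rw [hΛ]
        ring
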